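/- The terms of the distant call-by-value calculus dCBV are $M,N ::= x \mid \lambda x M \mid MN \mid M[N/x]$ (where $M[N/x]$ is an explicit substitution), up to renaming of bound variables. Values $V$ are variables and abstractions, and list contexts are $L ::= \square \mid L[N/x]$. The reduction $\to_v$ is the closure under all contexts of $$L\langle\lambda x M\rangle N \to_v L\langle M[N/x]\rangle ,\qquad M[L\langle V\rangle/x] \to_v L\langle M\{V/x\}\rangle .$$ Testing contexts are $T ::= \square \mid T\,N \mid (\lambda x T)\,N$. They may capture free variables of the term that is put in the hole. A term $M$ is dCBV-meaningful (scrutable) if $T\langle M\rangle \to_v^* V$ for some testing context $T$ and some value $V$. Resource terms are $m,n ::= x \mid \lambda x m \mid mn \mid \mathrm{der}\,m \mid m[n/x] \mid [m_1,\dots,m_k]$ with $k\ge 0$, where $[m_1,\dots,m_k]$ is a finite multiset. With list contexts $l ::= \square \mid l[n/x]$, resource reduction $\to$ is the closure under all contexts of the following rules, where $\emptyset$ is the empty sum, which every context absorbs: - $l\langle\lambda x m\rangle n \to l\langle m[n/x]\rangle$; - $m[l\langle[p_1,\dots,p_k]\rangle/x] \to l\langle m\{p_{\sigma(1)}/x_1,\dots,p_{\sigma(k)}/x_k\}\rangle$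 for every permutation $\sigma$ of $\{1,\dots,k\}$, if $x$ has exactly $k$ free occurrences $x_1,\dots,x_k$ in $m$, and $m[l\langle[p_1,\dots,p_k]\rangle/x]\to\emptyset$ otherwise; - $\mathrm{der}\,l\langle[m]\rangle \to l\langle m\rangle$, and $\mathrm{der}\,l\langle[m_1,\dots,m_k]\rangle \to \emptyset$ if $k\neq 1$. The approximation relation $m \lhd_v M$ between resource terms and dCBV terms is defined inductively: - $[x,\dots,x]_k \lhd_v x$ for every $k\ge 0$; - $[\lambda x m_1,\dots,\lambda x m_k] \lhd_v \lambda x M$ if $k\ge 0$ and $m_i\lhd_v M$ for all $i\le k$; - $(\mathrm{der}\,m)\,n \lhd_v MN$ if $M$ is not a value, $m\lhd_v M$ and $n\lhd_v N$; - $m\,n \lhd_v VN$ if $V$ is a value, $[m]\lhd_v V$ and $n\lhd_v N$; - $m[n/x] \lhd_v M[N/x]$ if $m\lhd_v M$ and $n\lhd_v N$. The Taylor normal form of $M$ is the set of all resource terms $p$ (so $p\ne\emptyset$) to which no reduction rule applies and such that $m\to^* p$ for some $m\lhd_v M$. **Corollary.** For every dCBV term $M$: $M$ is dCBV-meaningful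 if and only if the Taylor normal form of $M$ is non-empty. -/

import Mathlib

/-- Lifting of a renaming of de Bruijn indices under one binder. -/
def liftRen (ρ : ℕ → ℕ) : ℕ → ℕ
  | 0 => 0
  | j + 1 => ρ j + 1

/-! ### The distant call-by-value calculus

Terms are taken up to renaming of bound variables, so they are represented with de Bruijn indices.
The free variables are named by natural numbers: at binding depth `d`, the index `d + i` is the
free variable named `i`. -/

/-- Terms `M, N ::= x | λx M | M N | M[N/x]`. In `lam M` and in `es M N` (which is `M[N/x]`), the
index `0` of `M` is the bound variable. -/
inductive VTerm : Type
  | var (i : ℕ) : VTerm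
  | lam (M : VTerm) : VTerm
  | app (M N : VTerm) : VTerm
  | es (M N : VTerm) : VTerm

namespace VTerm

/-- Renaming of the free variables. -/
def rename (ρ : ℕ → ℕ) : VTerm → VTerm
  | var i => var (ρ i)
  | lam M => lam (rename (liftRen ρ) M)
  | app M N => app (rename ρ M) (rename ρ N)
  | es M N => es (rename (liftRen ρ) M) (rename ρ N)

/-- Lifting of a simultaneous substitution under one binder. -/
def liftSubst (σ : ℕ → VTerm) : ℕ → VTerm
  | 0 => var 0
  | j + 1 => rename Nat.succ (σ j)

/-- Capture-avoiding simultaneous substitution. -/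
def subst (σ : ℕ → VTerm) : VTerm → VTerm
  | var i => σ i
  | lam M => lam (subst (liftSubst σ) M)
  | app M N => app (subst σ M) (subst σ N)
  | es M N => es (subst (liftSubst σ) M) (subst σ N)

/-- `M{N/x}`, where `x` is the index `0` of `M`. -/
def inst (M N : VTerm) : VTerm :=
  subst (fun j => match j with
    | 0 => N
    | j + 1 => var j) M

/-- Values are the variables and the abstractions. -/
inductive IsValue : VTerm → Prop
  | var (i : ℕ) : IsValue (var i)
  | lam (M : VTerm) : IsValue (lam M)

/-- `L⟨M⟩` for the list context `L = □[N₁/x₁]…[Nₖ/xₖ]`, given as the list `[N₁, …, Nₖ]`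
(innermost explicit substitution first). The term `M` lies under the `k` binders of `L`. -/
def plugL : List VTerm → VTerm → VTerm
  | [], M => M
  | N :: L, M => plugL L (es M N)

/-- One-step reduction `→ᵥ`: the closure under all contexts of the two rules
`L⟨λx M⟩ N → L⟨M[N/x]⟩` and `M[L⟨V⟩/x] → L⟨M{V/x}⟩`. The term that enters the scope of the `k`
binders of `L` has its own free variables shifted by `k`, so that none of them is captured. -/
inductive Step : VTerm → VTerm → Prop
  | beta (L : List VTerm) (M N : VTerm) :
      Step (app (plugL L (lam M)) N) (plugL L (es M (rename (fun j => j + L.length) N)))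
  | sub (L : List VTerm) (M V : VTerm) (hV : IsValue V) :
      Step (es M (plugL L V)) (plugL L (inst (rename (liftRen (fun j => j + L.length)) M) V))
  | lam {M M' : VTerm} : Step M M' → Step (lam M) (lam M')
  | appL {M M' : VTerm} (N : VTerm) : Step M M' → Step (app M N) (app M' N)
  | appR (M : VTerm) {N N' : VTerm} : Step N N' → Step (app M N) (app M N')
  | esL {M M' : VTerm} (N : VTerm) : Step M M' → Step (es M N) (es M' N)
  | esR (M : VTerm) {N N' : VTerm} : Step N N' → Step (es M N) (es M N')

/-- `λx M`, where `x` is the free variable named `x` of `M`. -/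
def abs (x : ℕ) (M : VTerm) : VTerm :=
  lam (rename (fun j => if j = x then 0 else j + 1) M)

/-- Testing contexts `T ::= □ | T N | (λx T) N`. -/
inductive TestCtx : Type
  | hole : TestCtx
  | app (T : TestCtx) (N : VTerm) : TestCtx
  | absApp (x : ℕ) (T : TestCtx) (N : VTerm) : TestCtx

/-- `T⟨M⟩`; the abstractions of `T` capture the free variables of `M` that have their name. -/
def TestCtx.plug : TestCtx → VTerm → VTerm
  | .hole, M => M
  | .app T N, M => VTerm.app (T.plug M) N
  | .absApp x T N, M => VTerm.app (VTerm.abs x (T.plug M)) N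

/-- `M` is meaningful (scrutable): `T⟨M⟩` reduces to a value for some testing context `T`. -/
def Meaningful (M : VTerm) : Prop :=
  ∃ (T : TestCtx) (V : VTerm), IsValue V ∧ Relation.ReflTransGen Step (T.plug M) V

end VTerm

/-! ### The resource calculus

`ResPre` is the syntax of resource terms in which a bag `[m₁, …, mₖ]` is a list; a resource term
proper (`ResTerm` below) is a class of these up to permutation of the elements of bags. -/

/-- `m, n ::= x | λx m | m n | der m | m[n/x] | [m₁, …, mₖ]`, with de Bruijn indices as before. -/
inductive ResPre : Type
  | var (i : ℕ) : ResPre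
  | lam (m : ResPre) : ResPre
  | app (m n : ResPre) : ResPre
  | der (m : ResPre) : ResPre
  | es (m n : ResPre) : ResPre
  | bag (ms : List ResPre) : ResPre

namespace ResPre

mutual
/-- Renaming of the free variables. -/
def rename (ρ : ℕ → ℕ) : ResPre → ResPre
  | var i => var (ρ i)
  | lam m => lam (rename (liftRen ρ) m)
  | app m n => app (rename ρ m) (rename ρ n)
  | der m => der (rename ρ m)
  | es m n => es (rename (liftRen ρ) m) (rename ρ n)
  | bag ms => bag (renameList ρ ms)
/-- Renaming, in each element of a list. -/
def renameList (ρ : ℕ → ℕ) : List ResPre → List ResPre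
  | [] => []
  | m :: ms => rename ρ m :: renameList ρ ms
end

mutual
/-- `deg x m` is the number of free occurrences of the variable `x` in `m`. -/
def deg (x : ℕ) : ResPre → ℕ
  | var i => if i = x then 1 else 0
  | lam m => deg (x + 1) m
  | app m n => deg x m + deg x n
  | der m => deg x m
  | es m n => deg (x + 1) m + deg x n
  | bag ms => degList x ms
/-- The number of free occurrences of `x` in a list. -/
def degList (x : ℕ) : List ResPre → ℕ
  | [] => 0
  | m :: ms => deg x m + degList x ms
end

mutual
/-- Linear substitution: the `i`-th free occurrence (from the left, starting with `0`) of the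
variable `x` is replaced by `f i`, and the binder of `x` is removed (so indices above `x` go down
by one). -/
def lsub (x : ℕ) (f : ℕ → ResPre) : ResPre → ResPre
  | var i => if i = x then f 0 else if i < x then var i else var (i - 1)
  | lam m => lam (lsub (x + 1) (fun i => rename Nat.succ (f i)) m)
  | app m n => app (lsub x f m) (lsub x (fun i => f (i + deg x m)) n)
  | der m => der (lsub x f m)
  | es m n => es (lsub (x + 1) (fun i => rename Nat.succ (f i)) m)
      (lsub x (fun i => f (i + deg (x + 1) m)) n)
  | bag ms => bag (lsubList x f ms)
/-- Linear substitution in a list. -/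
def lsubList (x : ℕ) (f : ℕ → ResPre) : List ResPre → List ResPre
  | [] => []
  | m :: ms => lsub x f m :: lsubList x (fun i => f (i + deg x m)) ms
end

/-- `m{p₀/x₀, …, pₖ₋₁/xₖ₋₁}`, where `x₀, …, xₖ₋₁` are the occurrences of the index `0` in `m`.
It is used only for lists of length `deg 0 m`, so the default value is never taken. -/
def linst (m : ResPre) (ps : List ResPre) : ResPre :=
  lsub 0 (fun i => ps.getD i (var 0)) m

/-- `l⟨m⟩` for a list context `l = □[n₁/x₁]…[nₖ/xₖ]`, innermost explicit substitution first. -/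
def plugL : List ResPre → ResPre → ResPre
  | [], m => m
  | n :: l, m => plugL l (es m n)

/-- One-step resource reduction. The right-hand side is a resource term, or `none` for the empty
sum `∅`, which every context absorbs. The rules, closed under all contexts, are
`l⟨λx m⟩ n → l⟨m[n/x]⟩`;
`m[l⟨[p₁, …, pₖ]⟩/x] → l⟨m{p_σ(1)/x₁, …, p_σ(k)/xₖ}⟩` for every permutation `σ`, if `x` has exactly
`k` free occurrences in `m`, and `→ ∅` otherwise;
`der l⟨[m]⟩ → l⟨m⟩`, and `der l⟨[m₁, …, mₖ]⟩ → ∅` if `k ≠ 1`. -/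
inductive Step : ResPre → Option ResPre → Prop
  | beta (l : List ResPre) (m n : ResPre) :
      Step (app (plugL l (lam m)) n) (some (plugL l (es m (rename (fun j => j + l.length) n))))
  | sub (l : List ResPre) (m : ResPre) (ps qs : List ResPre) (hd : deg 0 m = ps.length)
      (hq : qs.Perm ps) :
      Step (es m (plugL l (bag ps)))
        (some (plugL l (linst (rename (liftRen (fun j => j + l.length)) m) qs)))
  | subZero (l : List ResPre) (m : ResPre) (ps : List ResPre) (hd : deg 0 m ≠ ps.length) :
      Step (es m (plugL l (bag ps))) none
  | der (l : List ResPre) (m : ResPre) : Step (der (plugL l (bag [m]))) (some (plugL l m))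
  | derZero (l : List ResPre) (ms : List ResPre) (hk : ms.length ≠ 1) :
      Step (der (plugL l (bag ms))) none
  | lamCtx {m : ResPre} {r : Option ResPre} : Step m r → Step (lam m) (r.map lam)
  | appL {m : ResPre} {r : Option ResPre} (n : ResPre) :
      Step m r → Step (app m n) (r.map fun m' => app m' n)
  | appR (m : ResPre) {n : ResPre} {r : Option ResPre} :
      Step n r → Step (app m n) (r.map fun n' => app m n')
  | derCtx {m : ResPre} {r : Option ResPre} : Step m r → Step (ResPre.der m) (r.map ResPre.der)
  | esL {m : ResPre} {r : Option ResPre} (n : ResPre) :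
      Step m r → Step (es m n) (r.map fun m' => es m' n)
  | esR (m : ResPre) {n : ResPre} {r : Option ResPre} :
      Step n r → Step (es m n) (r.map fun n' => es m n')
  | bagCtx (as bs : List ResPre) {m : ResPre} {r : Option ResPre} :
      Step m r → Step (bag (as ++ m :: bs)) (r.map fun m' => bag (as ++ m' :: bs))

/-- Equality up to permutation of the elements of bags: the least congruence that identifies
`[m₁, …, mₖ]` with each of its permutations. -/
inductive PermEq : ResPre → ResPre → Prop
  | refl (m : ResPre) : PermEq m m
  | symm {m n : ResPre} : PermEq m n → PermEq n m
  | trans {m n p : ResPre} : PermEq m n → PermEq n p → PermEq m p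
  | perm {ms ns : List ResPre} : ms.Perm ns → PermEq (bag ms) (bag ns)
  | lam {m m' : ResPre} : PermEq m m' → PermEq (lam m) (lam m')
  | app {m m' n n' : ResPre} : PermEq m m' → PermEq n n' → PermEq (app m n) (app m' n')
  | der {m m' : ResPre} : PermEq m m' → PermEq (der m) (der m')
  | es {m m' n n' : ResPre} : PermEq m m' → PermEq n n' → PermEq (es m n) (es m' n')
  | bag (as bs : List ResPre) {m m' : ResPre} :
      PermEq m m' → PermEq (bag (as ++ m :: bs)) (bag (as ++ m' :: bs))

instance instSetoid : Setoid ResPre where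
  r := PermEq
  iseqv := ⟨PermEq.refl, PermEq.symm, PermEq.trans⟩

/-- The approximation relation `m ⊲ᵥ M` between resource terms and call-by-value terms. -/
inductive ApproxV : ResPre → VTerm → Prop
  | var (k i : ℕ) : ApproxV (bag (List.replicate k (var i))) (VTerm.var i)
  | lam (ms : List ResPre) (M : VTerm) :
      (∀ m ∈ ms, ApproxV m M) → ApproxV (bag (ms.map lam)) (VTerm.lam M)
  | appDer {m n : ResPre} {M N : VTerm} : ¬ VTerm.IsValue M →
      ApproxV m M → ApproxV n N → ApproxV (app (der m) n) (VTerm.app M N)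
  | appVal {m n : ResPre} {V N : VTerm} : VTerm.IsValue V →
      ApproxV (bag [m]) V → ApproxV n N → ApproxV (app m n) (VTerm.app V N)
  | es {m n : ResPre} {M N : VTerm} :
      ApproxV m M → ApproxV n N → ApproxV (es m n) (VTerm.es M N)

end ResPre

/-- Resource terms: bags are finite multisets. -/
def ResTerm : Type := Quotient ResPre.instSetoid

namespace ResTerm

/-- The resource term with the given representative. -/
def mk (m : ResPre) : ResTerm := Quotient.mk ResPre.instSetoid m

/-- One-step resource reduction, to a resource term or to `∅` (`none`). -/
def Step (t : ResTerm) (u : Option ResTerm) : Prop :=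
  ∃ (m : ResPre) (r : Option ResPre), mk m = t ∧ r.map mk = u ∧ ResPre.Step m r

/-- A resource term is normal if no rule applies to it, including those with result `∅`. -/
def IsNormal (t : ResTerm) : Prop := ∀ u, ¬ Step t u

/-- `u` is a normal form of `t`: a normal resource term (hence not `∅`) to which `t` reduces. -/
def IsNormalFormOf (u t : ResTerm) : Prop :=
  Relation.ReflTransGen (fun a b => Step a (some b)) t u ∧ IsNormal u

end ResTerm

namespace VTerm

/-- The Taylor expansion of `M`: the set of its resource approximants. -/
def taylor (M : VTerm) : Set ResTerm :=
  {t | ∃ m : ResPre, ResTerm.mk m = t ∧ ResPre.ApproxV m M}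

/-- The Taylor normal form of `M`: the normal forms of its resource approximants. -/
def taylorNF (M : VTerm) : Set ResTerm :=
  {u | ∃ t ∈ taylor M, ResTerm.IsNormalFormOf u t}

end VTerm

-- Both calculi carry a non-idempotent intersection type system, in which every declaration in a
-- context is consumed exactly once and a binder turns its declarations into the bag type of the
-- argument. Typability mediates between meaningfulness and the Taylor normal form.
--
-- If `M` is meaningful, some `T⟨M⟩` reduces to a value, and every value has the empty bag type in
-- the empty context. Subject expansion (`VTerm.Step.hasTy_of_hasTy`) carries this typing back to
-- `T⟨M⟩`, and a testing context never erases its hole, so `M` is typable. A derivation for `M`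
-- records how often each value is used, and so describes an approximant with the same typing
-- (`VTerm.HasTy.exists_approxV`). A typable resource term that is not normal has a typable reduct
-- (`ResPre.Step.exists_hasTy`), and resource steps shrink terms, so the approximant has a non-zero
-- normal form.
--
-- Conversely, normal forms of approximants are typable (`ResPre.Normal.typable`): sorts rule out
-- clashes, and whatever is stuck has every type. Subject expansion for resource terms transfers the
-- typing to the approximant `m` itself. Types are then read as sets of values. If `m` approximates
-- `M`, a typing of `m` makes `M` reduce to a value once its variables are replaced by realizers of
-- their declared types (`VTerm.exists_steps_realizes`). The terms `λx₀ … λxₖ xₖ` with `k` large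
-- realize any given type, and a testing context performs the substitution.

-- Types and typing contexts

/-- Types: `arr A B` for linear functions and `bag As` for finite multisets, given as lists. -/
inductive Ty : Type
  | arr (A B : Ty) : Ty
  | bag (As : List Ty) : Ty

/-- Typing contexts: finite multisets of declarations of variables. -/
abbrev TyCtx : Type := Multiset (ℕ × Ty)

namespace TyCtx

/-- The context that declares `x` with each of the types `As`. -/
def single (x : ℕ) (As : List Ty) : TyCtx := (As.map (Prod.mk x) : Multiset (ℕ × Ty))

/-- Renaming of the variables of a context. -/
def ren (ρ : ℕ → ℕ) (Γ : TyCtx) : TyCtx := Γ.map (Prod.map ρ id)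

/-- The types with which `x` is declared. -/
def proj (x : ℕ) (Γ : TyCtx) : Multiset Ty :=
  Γ.filterMap fun p => if p.1 = x then some p.2 else none

/-- Removal of the declarations of `x`, and of the index `x`. -/
def unbind (x : ℕ) (Γ : TyCtx) : TyCtx :=
  Γ.filterMap fun p =>
    if p.1 = x then none else some (if p.1 < x then p.1 else p.1 - 1, p.2)

@[simp] theorem ren_zero (ρ : ℕ → ℕ) : ren ρ 0 = 0 := rfl
@[simp] theorem proj_zero (x : ℕ) : proj x 0 = 0 := rfl
@[simp] theorem unbind_zero (x : ℕ) : unbind x 0 = 0 := rfl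

@[simp] theorem ren_add (ρ : ℕ → ℕ) (Γ Δ : TyCtx) : ren ρ (Γ + Δ) = ren ρ Γ + ren ρ Δ :=
  Multiset.map_add _ _ _

@[simp] theorem proj_add (x : ℕ) (Γ Δ : TyCtx) : proj x (Γ + Δ) = proj x Γ + proj x Δ :=
  Multiset.filterMap_add _ _ _

@[simp] theorem unbind_add (x : ℕ) (Γ Δ : TyCtx) :
    unbind x (Γ + Δ) = unbind x Γ + unbind x Δ :=
  Multiset.filterMap_add _ _ _

theorem ren_id (Γ : TyCtx) : ren (fun j => j) Γ = Γ := Multiset.map_id Γ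

@[simp] theorem single_nil (x : ℕ) : single x [] = 0 := rfl

theorem single_append (x : ℕ) (As Bs : List Ty) :
    single x (As ++ Bs) = single x As + single x Bs := by
  simp [single]

theorem single_cons (x : ℕ) (A : Ty) (As : List Ty) :
    single x (A :: As) = single x [A] + single x As :=
  single_append x [A] As

theorem ren_single (ρ : ℕ → ℕ) (x : ℕ) (As : List Ty) :
    ren ρ (single x As) = single (ρ x) As := by
  simp [ren, single, Function.comp_def]

theorem proj_single_self (x : ℕ) (As : List Ty) : proj x (single x As) = As := by
  simp [proj, single, List.filterMap_map]

theorem proj_single_of_ne {x y : ℕ} (h : y ≠ x) (As : List Ty) : proj x (single y As) = 0 := by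
  simp [proj, single, List.filterMap_map, h]

theorem unbind_single_self (x : ℕ) (As : List Ty) : unbind x (single x As) = 0 := by
  simp [unbind, single, List.filterMap_map]

theorem unbind_single_of_ne {x y : ℕ} (h : y ≠ x) (As : List Ty) :
    unbind x (single y As) = single (if y < x then y else y - 1) As := by
  simp [unbind, single, List.filterMap_map, h]

@[simp] theorem proj_zero_ren_liftRen (ρ : ℕ → ℕ) (Γ : TyCtx) :
    proj 0 (ren (liftRen ρ) Γ) = proj 0 Γ := by
  simp only [proj, ren, Multiset.filterMap_map]
  congr 1
  funext ⟨i, A⟩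
  cases i <;> simp [liftRen]

@[simp] theorem unbind_zero_ren_liftRen (ρ : ℕ → ℕ) (Γ : TyCtx) :
    unbind 0 (ren (liftRen ρ) Γ) = ren ρ (unbind 0 Γ) := by
  simp only [unbind, ren, Multiset.filterMap_map, Multiset.map_filterMap]
  congr 1
  funext ⟨i, A⟩
  cases i <;> simp [liftRen]

@[simp] theorem proj_zero_ren_succ (ρ : ℕ → ℕ) (Γ : TyCtx) :
    proj 0 (ren (fun j => ρ j + 1) Γ) = 0 := by
  simp only [proj, ren, Multiset.filterMap_map]
  induction Γ using Multiset.induction <;> simp_all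

@[simp] theorem unbind_zero_ren_succ (ρ : ℕ → ℕ) (Γ : TyCtx) :
    unbind 0 (ren (fun j => ρ j + 1) Γ) = ren ρ Γ := by
  simp only [unbind, ren, Multiset.filterMap_map]
  rw [← Multiset.filterMap_eq_map]
  rfl

@[simp] theorem proj_zero_ren_nat_succ (Γ : TyCtx) : proj 0 (ren Nat.succ Γ) = 0 :=
  proj_zero_ren_succ (fun j => j) Γ

@[simp] theorem unbind_zero_ren_nat_succ (Γ : TyCtx) : unbind 0 (ren Nat.succ Γ) = Γ :=
  (unbind_zero_ren_succ (fun j => j) Γ).trans (ren_id Γ)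

theorem proj_unbind_zero (x : ℕ) (Γ : TyCtx) : proj x (unbind 0 Γ) = proj (x + 1) Γ := by
  simp only [unbind, proj, Multiset.filterMap_filterMap]
  congr 1
  funext ⟨i, A⟩
  cases i <;> simp

theorem proj_zero_unbind_succ (x : ℕ) (Γ : TyCtx) : proj 0 (unbind (x + 1) Γ) = proj 0 Γ := by
  simp only [unbind, proj, Multiset.filterMap_filterMap]
  congr 1
  funext ⟨i, A⟩
  rcases i with _ | i
  · simp
  · by_cases h : i = x
    · simp [h]
    · by_cases h' : i < x
      · simp [h, h']
      · have : i ≠ 0 := by omega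
        simp [h, h', this]

theorem unbind_zero_unbind_succ (x : ℕ) (Γ : TyCtx) :
    unbind 0 (unbind (x + 1) Γ) = unbind x (unbind 0 Γ) := by
  simp only [unbind, Multiset.filterMap_filterMap]
  congr 1
  funext ⟨i, A⟩
  rcases i with _ | i
  · simp
  · by_cases h : i = x
    · simp [h]
    · by_cases h' : i < x
      · simp [h, h']
      · have : i ≠ 0 := by omega
        simp [h, h', this]

theorem mem_unbind_zero {Γ : TyCtx} {i : ℕ} {A : Ty} (h : (i + 1, A) ∈ Γ) :
    (i, A) ∈ unbind 0 Γ :=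
  (Multiset.mem_filterMap _ _).2 ⟨_, h, by simp⟩

theorem mem_proj {Γ : TyCtx} {i : ℕ} {A : Ty} (h : (i, A) ∈ Γ) : A ∈ proj i Γ :=
  (Multiset.mem_filterMap _ _).2 ⟨_, h, by simp⟩

end TyCtx

-- Typing of resource terms

namespace ResPre

mutual
/-- `HasTy m Γ A`: the resource term `m` has the type `A` in the context `Γ`. -/
def HasTy : ResPre → TyCtx → Ty → Prop
  | var i, Γ, A => Γ = TyCtx.single i [A]
  | lam m, Γ, T => ∃ Θ As B, T = Ty.arr (Ty.bag As) B ∧ TyCtx.proj 0 Θ = As ∧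
      Γ = TyCtx.unbind 0 Θ ∧ HasTy m Θ B
  | app m n, Γ, B => ∃ Γ₁ Γ₂ A, Γ = Γ₁ + Γ₂ ∧ HasTy m Γ₁ (Ty.arr A B) ∧ HasTy n Γ₂ A
  | der m, Γ, A => HasTy m Γ (Ty.bag [A])
  | es m n, Γ, B => ∃ Θ Γ₂ As, TyCtx.proj 0 Θ = (As : List Ty) ∧ Γ = TyCtx.unbind 0 Θ + Γ₂ ∧
      HasTy m Θ B ∧ HasTy n Γ₂ (Ty.bag As)
  | bag ms, Γ, T => ∃ As Bs, T = Ty.bag Bs ∧ As.Perm Bs ∧ HasTys ms Γ As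
/-- The elements of a list have the types in a list. -/
def HasTys : List ResPre → TyCtx → List Ty → Prop
  | [], Γ, As => Γ = 0 ∧ As = []
  | m :: ms, Γ, As => ∃ Γ₁ Γ₂ A As', Γ = Γ₁ + Γ₂ ∧ As = A :: As' ∧ HasTy m Γ₁ A ∧
      HasTys ms Γ₂ As'
end

theorem HasTys.length {ms : List ResPre} : ∀ {Γ : TyCtx} {As : List Ty}, HasTys ms Γ As →
    As.length = ms.length := by
  induction ms with
  | nil => rintro Γ As ⟨_, rfl⟩; rfl
  | cons m ms ih =>
    rintro Γ As ⟨Γ₁, Γ₂, A, As', rfl, rfl, -, h⟩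
    simp [ih h]

theorem hasTys_append {ms ns : List ResPre} : ∀ {Γ : TyCtx} {As : List Ty},
    HasTys (ms ++ ns) Γ As ↔ ∃ Γ₁ Γ₂ As₁ As₂, Γ = Γ₁ + Γ₂ ∧ As = As₁ ++ As₂ ∧
      HasTys ms Γ₁ As₁ ∧ HasTys ns Γ₂ As₂ := by
  induction ms with
  | nil =>
    intro Γ As
    constructor
    · intro h
      exact ⟨0, Γ, [], As, by simp, rfl, ⟨rfl, rfl⟩, h⟩
    · rintro ⟨_, Γ₂, _, As₂, rfl, rfl, ⟨rfl, rfl⟩, h⟩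
      simpa using h
  | cons m ms ih =>
    intro Γ As
    constructor
    · rintro ⟨Γ₁, Γ₂, A, As', rfl, rfl, h₁, h⟩
      obtain ⟨Δ₁, Δ₂, Bs₁, Bs₂, rfl, rfl, h₂, h₃⟩ := ih.1 h
      exact ⟨Γ₁ + Δ₁, Δ₂, A :: Bs₁, Bs₂, by rw [add_assoc], rfl,
        ⟨Γ₁, Δ₁, A, Bs₁, rfl, rfl, h₁, h₂⟩, h₃⟩
    · rintro ⟨_, Δ₂, _, Bs₂, rfl, rfl, ⟨Γ₁, Δ₁, A, Bs₁, rfl, rfl, h₁, h₂⟩, h₃⟩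
      exact ⟨Γ₁, Δ₁ + Δ₂, A, Bs₁ ++ Bs₂, by rw [add_assoc], rfl, h₁,
        ih.2 ⟨Δ₁, Δ₂, Bs₁, Bs₂, rfl, rfl, h₂, h₃⟩⟩

theorem HasTys.perm_terms {ms ns : List ResPre} (hp : ms.Perm ns) : ∀ {Γ : TyCtx} {As : List Ty},
    HasTys ms Γ As → ∃ Bs, Bs.Perm As ∧ HasTys ns Γ Bs := by
  induction hp with
  | nil => intro Γ As h; exact ⟨As, .refl _, h⟩
  | cons m _ ih =>
    rintro Γ As ⟨Γ₁, Γ₂, A, As', rfl, rfl, h₁, h⟩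
    obtain ⟨Bs, hB, h'⟩ := ih h
    exact ⟨A :: Bs, hB.cons A, Γ₁, Γ₂, A, Bs, rfl, rfl, h₁, h'⟩
  | swap m n ms =>
    rintro Γ As ⟨Γ₁, _, A, _, rfl, rfl, h₁, Γ₂, Γ₃, B, As', rfl, rfl, h₂, h⟩
    exact ⟨B :: A :: As', .swap _ _ _, Γ₂, Γ₁ + Γ₃, B, A :: As', by abel, rfl, h₂, Γ₁, Γ₃, A, As',
      rfl, rfl, h₁, h⟩
  | trans _ _ ih₁ ih₂ =>
    intro Γ As h
    obtain ⟨Bs, hB, h'⟩ := ih₁ h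
    obtain ⟨Cs, hC, h''⟩ := ih₂ h'
    exact ⟨Cs, hC.trans hB, h''⟩

/-- Reordering the types reorders the terms with them. This selects the permutation with which the
substitution rule has to fire. -/
theorem HasTys.perm_types {As Bs : List Ty} (hp : As.Perm Bs) : ∀ {Γ : TyCtx} {ms : List ResPre},
    HasTys ms Γ As → ∃ ns, ns.Perm ms ∧ HasTys ns Γ Bs := by
  induction hp with
  | nil => intro Γ ms h; exact ⟨ms, .refl _, h⟩
  | cons A _ ih =>
    intro Γ ms h
    cases ms with
    | nil => simp [HasTys] at h
    | cons m ms =>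
      obtain ⟨Γ₁, Γ₂, A, As', rfl, he, h₁, h⟩ := h
      cases he
      obtain ⟨ns, hB, h'⟩ := ih h
      exact ⟨m :: ns, hB.cons m, Γ₁, Γ₂, A, _, rfl, rfl, h₁, h'⟩
  | swap A B As =>
    intro Γ ms h
    rcases ms with _ | ⟨m, _ | ⟨n, ms⟩⟩
    · simp [HasTys] at h
    · simp [HasTys] at h
    · obtain ⟨Γ₁, _, A, _, rfl, he, h₁, Γ₂, Γ₃, B, As', rfl, he', h₂, h⟩ := h
      cases he
      cases he'
      exact ⟨n :: m :: ms, .swap _ _ _, Γ₂, Γ₁ + Γ₃, A, B :: As, by abel, rfl, h₂, Γ₁, Γ₃, B, As,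
        rfl, rfl, h₁, h⟩
  | trans _ _ ih₁ ih₂ =>
    intro Γ As h
    obtain ⟨Bs, hB, h'⟩ := ih₁ h
    obtain ⟨Cs, hC, h''⟩ := ih₂ h'
    exact ⟨Cs, hC.trans hB, h''⟩

mutual
theorem HasTy.rename (ρ : ℕ → ℕ) : ∀ (m : ResPre) {Γ : TyCtx} {A : Ty}, HasTy m Γ A →
    HasTy (rename ρ m) (TyCtx.ren ρ Γ) A
  | var i, Γ, A, h => by
    cases h
    exact TyCtx.ren_single ρ i [A]
  | lam m, Γ, A, h => by
    obtain ⟨Θ, As, B, rfl, hp, rfl, h⟩ := h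
    exact ⟨_, As, B, rfl, by simpa using hp, by simp, HasTy.rename (liftRen ρ) m h⟩
  | app m n, Γ, A, h => by
    obtain ⟨Γ₁, Γ₂, A, rfl, h₁, h₂⟩ := h
    exact ⟨_, _, A, by simp, HasTy.rename ρ m h₁, HasTy.rename ρ n h₂⟩
  | der m, Γ, A, h => HasTy.rename ρ m (A := Ty.bag [A]) h
  | es m n, Γ, A, h => by
    obtain ⟨Θ, Γ₂, As, hp, rfl, h₁, h₂⟩ := h
    exact ⟨_, _, As, by simpa using hp, by simp, HasTy.rename (liftRen ρ) m h₁,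
      HasTy.rename ρ n h₂⟩
  | bag ms, Γ, A, h => by
    obtain ⟨As, Bs, rfl, hp, h⟩ := h
    exact ⟨As, Bs, rfl, hp, HasTys.rename ρ ms h⟩
theorem HasTys.rename (ρ : ℕ → ℕ) : ∀ (ms : List ResPre) {Γ : TyCtx} {As : List Ty},
    HasTys ms Γ As → HasTys (renameList ρ ms) (TyCtx.ren ρ Γ) As
  | [], Γ, As, h => by
    obtain ⟨rfl, rfl⟩ := h
    exact ⟨rfl, rfl⟩
  | m :: ms, Γ, As, h => by
    obtain ⟨Γ₁, Γ₂, A, As', rfl, rfl, h₁, h₂⟩ := h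
    exact ⟨_, _, A, As', by simp, rfl, HasTy.rename ρ m h₁, HasTys.rename ρ ms h₂⟩
end

-- Even for a non-injective renaming the context can be pulled back: each occurrence of a variable
-- has its own declaration, which takes the original name of that occurrence.
mutual
theorem HasTy.of_rename (ρ : ℕ → ℕ) : ∀ (m : ResPre) {Δ : TyCtx} {A : Ty},
    HasTy (ResPre.rename ρ m) Δ A → ∃ Γ, Δ = TyCtx.ren ρ Γ ∧ HasTy m Γ A
  | var i, Γ, A, h => ⟨TyCtx.single i [A], by
      rw [TyCtx.ren_single]
      exact h, rfl⟩
  | lam m, Γ, A, h => by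
    obtain ⟨Θ, As, B, rfl, hp, rfl, h⟩ := h
    obtain ⟨Θ, rfl, h'⟩ := HasTy.of_rename (liftRen ρ) m h
    exact ⟨TyCtx.unbind 0 Θ, by simp, Θ, As, B, rfl, by simpa using hp, rfl, h'⟩
  | app m n, Γ, A, h => by
    obtain ⟨Γ₁, Γ₂, A, rfl, h₁, h₂⟩ := h
    obtain ⟨Γ₁, rfl, h₁'⟩ := HasTy.of_rename ρ m h₁
    obtain ⟨Γ₂, rfl, h₂'⟩ := HasTy.of_rename ρ n h₂
    exact ⟨Γ₁ + Γ₂, by simp, _, _, A, rfl, h₁', h₂'⟩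
  | der m, Γ, A, h => HasTy.of_rename ρ m (A := Ty.bag [A]) h
  | es m n, Γ, A, h => by
    obtain ⟨Θ, Γ₂, As, hp, rfl, h₁, h₂⟩ := h
    obtain ⟨Θ, rfl, h₁'⟩ := HasTy.of_rename (liftRen ρ) m h₁
    obtain ⟨Γ₂, rfl, h₂'⟩ := HasTy.of_rename ρ n h₂
    exact ⟨TyCtx.unbind 0 Θ + Γ₂, by simp, Θ, _, As, by simpa using hp, rfl, h₁', h₂'⟩
  | bag ms, Γ, A, h => by
    obtain ⟨As, Bs, rfl, hp, h⟩ := h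
    obtain ⟨Γ, rfl, h'⟩ := HasTys.of_rename ρ ms h
    exact ⟨Γ, rfl, As, Bs, rfl, hp, h'⟩
theorem HasTys.of_rename (ρ : ℕ → ℕ) : ∀ (ms : List ResPre) {Δ : TyCtx} {As : List Ty},
    HasTys (renameList ρ ms) Δ As → ∃ Γ, Δ = TyCtx.ren ρ Γ ∧ HasTys ms Γ As
  | [], Γ, As, h => by
    obtain ⟨rfl, rfl⟩ := h
    exact ⟨0, rfl, rfl, rfl⟩
  | m :: ms, Γ, As, h => by
    obtain ⟨Γ₁, Γ₂, A, As', rfl, rfl, h₁, h₂⟩ := h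
    obtain ⟨Γ₁, rfl, h₁'⟩ := HasTy.of_rename ρ m h₁
    obtain ⟨Γ₂, rfl, h₂'⟩ := HasTys.of_rename ρ ms h₂
    exact ⟨Γ₁ + Γ₂, by simp, _, _, A, As', rfl, rfl, h₁', h₂'⟩
end

-- Linearity: each free occurrence consumes exactly one declaration. Hence typing excludes the rules
-- that yield `∅` because of a wrong number of occurrences.
mutual
theorem HasTy.card_proj : ∀ (m : ResPre) (x : ℕ) {Γ : TyCtx} {A : Ty}, HasTy m Γ A →
    (TyCtx.proj x Γ).card = deg x m
  | var i, x, Γ, A, h => by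
    cases h
    by_cases hx : i = x
    · subst hx
      simp [TyCtx.proj_single_self, deg]
    · simp [TyCtx.proj_single_of_ne hx, deg, hx]
  | lam m, x, Γ, A, h => by
    obtain ⟨Θ, As, B, rfl, hp, rfl, h⟩ := h
    rw [TyCtx.proj_unbind_zero, deg, HasTy.card_proj m _ h]
  | app m n, x, Γ, A, h => by
    obtain ⟨Γ₁, Γ₂, A, rfl, h₁, h₂⟩ := h
    simp [deg, HasTy.card_proj m x h₁, HasTy.card_proj n x h₂]
  | der m, x, Γ, A, h => HasTy.card_proj m x (A := Ty.bag [A]) h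
  | es m n, x, Γ, A, h => by
    obtain ⟨Θ, Γ₂, As, hp, rfl, h₁, h₂⟩ := h
    simp [deg, TyCtx.proj_unbind_zero, HasTy.card_proj m _ h₁, HasTy.card_proj n x h₂]
  | bag ms, x, Γ, A, h => by
    obtain ⟨As, Bs, rfl, hp, h⟩ := h
    exact HasTys.card_proj ms x h
theorem HasTys.card_proj : ∀ (ms : List ResPre) (x : ℕ) {Γ : TyCtx} {As : List Ty},
    HasTys ms Γ As → (TyCtx.proj x Γ).card = degList x ms
  | [], x, Γ, As, h => by
    obtain ⟨rfl, rfl⟩ := h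
    rfl
  | m :: ms, x, Γ, As, h => by
    obtain ⟨Γ₁, Γ₂, A, As', rfl, rfl, h₁, h₂⟩ := h
    simp [degList, HasTy.card_proj m x h₁, HasTys.card_proj ms x h₂]
end

end ResPre

-- Typing under list contexts, for both calculi

namespace TyCtx

/-- The typing of list contexts: `ListTy l Θ Γ` says that a term with context `Θ` yields a term with
context `Γ` when it is put under the explicit substitutions with the typing judgements in `l`. -/
def ListTy : List (TyCtx → Ty → Prop) → TyCtx → TyCtx → Prop
  | [], Θ, Γ => Γ = Θ
  | P :: l, Θ, Γ => ∃ Δ As, proj 0 Θ = (As : List Ty) ∧ P Δ (Ty.bag As) ∧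
      ListTy l (unbind 0 Θ + Δ) Γ

/-- The shift puts all declarations of `G` beyond the `k` binders, so they pass through the list
context untouched. This is how arguments move in and out of `L` in the rules at a distance. -/
theorem listTy_add {l : List (TyCtx → Ty → Prop)} : ∀ {k : ℕ}, l.length = k →
    ∀ {Θ G Γ' : TyCtx}, ListTy l (Θ + ren (fun j => j + k) G) Γ' ↔
      ∃ Γ, Γ' = Γ + G ∧ ListTy l Θ Γ := by
  induction l with
  | nil =>
    rintro _ rfl Θ G Γ'
    constructor
    · intro h
      exact ⟨Θ, by rw [← ren_id G]; exact h, rfl⟩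
    · rintro ⟨_, rfl, rfl⟩
      exact congrArg _ (ren_id G).symm
  | cons P l ih =>
    rintro _ rfl Θ G Γ'
    have hp : proj 0 (ren (fun j => j + (P :: l).length) G) = 0 :=
      proj_zero_ren_succ (fun j => j + l.length) G
    have hu : unbind 0 (ren (fun j => j + (P :: l).length) G) = ren (fun j => j + l.length) G :=
      unbind_zero_ren_succ (fun j => j + l.length) G
    simp only [ListTy, proj_add, unbind_add, hp, hu, add_zero, add_right_comm _ (ren _ G), ih rfl]
    constructor
    · rintro ⟨Δ, As, h₁, h₂, Γ, rfl, h₃⟩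
      exact ⟨Γ, rfl, Δ, As, h₁, h₂, h₃⟩
    · rintro ⟨Γ, rfl, Δ, As, h₁, h₂, h₃⟩
      exact ⟨Δ, As, h₁, h₂, Γ, rfl, h₃⟩

end TyCtx

-- Linear substitution

namespace ResPre

theorem renameList_eq_map (ρ : ℕ → ℕ) (ms : List ResPre) :
    renameList ρ ms = ms.map (rename ρ) := by
  induction ms with
  | nil => rfl
  | cons m ms ih => simp [renameList, ih]

theorem map_range_add {α : Type*} (f : ℕ → α) (a b : ℕ) :
    (List.range (a + b)).map f =
      (List.range a).map f ++ (List.range b).map fun i => f (i + a) := by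
  simp [List.range_add, Function.comp_def, add_comm]

theorem HasTys.map_rename (ρ : ℕ → ℕ) {f : ℕ → ResPre} {l : List ℕ} {Γ : TyCtx} {As : List Ty}
    (h : HasTys (l.map f) Γ As) :
    HasTys (l.map fun i => ResPre.rename ρ (f i)) (TyCtx.ren ρ Γ) As := by
  have := HasTys.rename ρ _ h
  rwa [renameList_eq_map, List.map_map] at this

theorem HasTys.of_map_rename (ρ : ℕ → ℕ) {f : ℕ → ResPre} {l : List ℕ} {Δ : TyCtx}
    {As : List Ty} (h : HasTys (l.map fun i => ResPre.rename ρ (f i)) Δ As) :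
    ∃ Γ, Δ = TyCtx.ren ρ Γ ∧ HasTys (l.map f) Γ As := by
  apply HasTys.of_rename ρ
  rwa [renameList_eq_map, List.map_map]

-- `As` lists the types of the occurrences of `x` from left to right. It depends on the derivation
-- only and is produced before `f`, so that the elements of a bag can then be ordered to match it.
mutual
theorem HasTy.lsub : ∀ (m : ResPre) (x : ℕ) {Γ : TyCtx} {A : Ty}, HasTy m Γ A →
    ∃ As : List Ty, TyCtx.proj x Γ = As ∧ ∀ (f : ℕ → ResPre) (Δ : TyCtx),
      HasTys ((List.range (deg x m)).map f) Δ As →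
        HasTy (ResPre.lsub x f m) (TyCtx.unbind x Γ + Δ) A
  | var i, x, Γ, A, h => by
    cases h
    by_cases hx : i = x
    · subst hx
      refine ⟨[A], TyCtx.proj_single_self _ _, fun f Δ h => ?_⟩
      simp only [deg, if_true, List.range_one, List.map_cons, List.map_nil, HasTys] at h
      obtain ⟨Γ₁, Γ₂, A, As', rfl, he, h, rfl, rfl⟩ := h
      cases he
      simpa [ResPre.lsub, TyCtx.unbind_single_self] using h
    · refine ⟨[], TyCtx.proj_single_of_ne hx _, fun f Δ h => ?_⟩
      simp only [deg, hx, if_false, List.range_zero, List.map_nil, HasTys] at h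
      obtain ⟨rfl, -⟩ := h
      rw [TyCtx.unbind_single_of_ne hx, add_zero, ResPre.lsub, if_neg hx]
      split_ifs <;> rfl
  | lam m, x, Γ, A, h => by
    obtain ⟨Θ, Cs, B, rfl, hp, rfl, h⟩ := h
    obtain ⟨As, hA, ih⟩ := HasTy.lsub m (x + 1) h
    refine ⟨As, by rw [TyCtx.proj_unbind_zero, hA], fun f Δ hf => ?_⟩
    exact ⟨_, Cs, B, rfl, by simp [TyCtx.proj_zero_unbind_succ, hp],
      by simp [TyCtx.unbind_zero_unbind_succ], ih _ _ (HasTys.map_rename Nat.succ hf)⟩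
  | app m n, x, Γ, A, h => by
    obtain ⟨Γ₁, Γ₂, B, rfl, h₁, h₂⟩ := h
    obtain ⟨As₁, hA₁, ih₁⟩ := HasTy.lsub m x h₁
    obtain ⟨As₂, hA₂, ih₂⟩ := HasTy.lsub n x h₂
    refine ⟨As₁ ++ As₂, by simp [hA₁, hA₂], fun f Δ hf => ?_⟩
    rw [deg, map_range_add, hasTys_append] at hf
    obtain ⟨Δ₁, Δ₂, Bs₁, Bs₂, rfl, he, hf₁, hf₂⟩ := hf
    -- Both splittings are at the number of occurrences of `x` in `m`, by linearity.
    obtain ⟨rfl, rfl⟩ := List.append_inj he (by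
      rw [hf₁.length, ← Multiset.coe_card, ← hA₁, HasTy.card_proj m x h₁]; simp)
    exact ⟨_, _, B, by simp only [TyCtx.unbind_add]; abel, ih₁ _ _ hf₁, ih₂ _ _ hf₂⟩
  | der m, x, Γ, A, h => HasTy.lsub m x (A := Ty.bag [A]) h
  | es m n, x, Γ, A, h => by
    obtain ⟨Θ, Γ₂, Cs, hp, rfl, h₁, h₂⟩ := h
    obtain ⟨As₁, hA₁, ih₁⟩ := HasTy.lsub m (x + 1) h₁
    obtain ⟨As₂, hA₂, ih₂⟩ := HasTy.lsub n x h₂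
    refine ⟨As₁ ++ As₂, by simp [TyCtx.proj_unbind_zero, hA₁, hA₂], fun f Δ hf => ?_⟩
    rw [deg, map_range_add, hasTys_append] at hf
    obtain ⟨Δ₁, Δ₂, Bs₁, Bs₂, rfl, he, hf₁, hf₂⟩ := hf
    obtain ⟨rfl, rfl⟩ := List.append_inj he (by
      rw [hf₁.length, ← Multiset.coe_card, ← hA₁, HasTy.card_proj m (x + 1) h₁]; simp)
    exact ⟨_, _, Cs, by simp [TyCtx.proj_zero_unbind_succ, hp],
      by simp only [TyCtx.unbind_add, TyCtx.unbind_zero_unbind_succ,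
          TyCtx.unbind_zero_ren_nat_succ]; abel,
      ih₁ _ _ (HasTys.map_rename Nat.succ hf₁), ih₂ _ _ hf₂⟩
  | bag ms, x, Γ, A, h => by
    obtain ⟨Cs, Bs, rfl, hp, h⟩ := h
    obtain ⟨As, hA, ih⟩ := HasTys.lsub ms x h
    exact ⟨As, hA, fun f Δ hf => ⟨Cs, Bs, rfl, hp, ih f Δ hf⟩⟩
theorem HasTys.lsub : ∀ (ms : List ResPre) (x : ℕ) {Γ : TyCtx} {Cs : List Ty}, HasTys ms Γ Cs →
    ∃ As : List Ty, TyCtx.proj x Γ = As ∧ ∀ (f : ℕ → ResPre) (Δ : TyCtx),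
      HasTys ((List.range (degList x ms)).map f) Δ As →
        HasTys (lsubList x f ms) (TyCtx.unbind x Γ + Δ) Cs
  | [], x, Γ, Cs, h => by
    obtain ⟨rfl, rfl⟩ := h
    refine ⟨[], rfl, fun f Δ hf => ?_⟩
    obtain ⟨rfl, -⟩ := hf
    exact ⟨rfl, rfl⟩
  | m :: ms, x, Γ, Cs, h => by
    obtain ⟨Γ₁, Γ₂, B, Cs', rfl, rfl, h₁, h₂⟩ := h
    obtain ⟨As₁, hA₁, ih₁⟩ := HasTy.lsub m x h₁
    obtain ⟨As₂, hA₂, ih₂⟩ := HasTys.lsub ms x h₂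
    refine ⟨As₁ ++ As₂, by simp [hA₁, hA₂], fun f Δ hf => ?_⟩
    rw [degList, map_range_add, hasTys_append] at hf
    obtain ⟨Δ₁, Δ₂, Bs₁, Bs₂, rfl, he, hf₁, hf₂⟩ := hf
    obtain ⟨rfl, rfl⟩ := List.append_inj he (by
      rw [hf₁.length, ← Multiset.coe_card, ← hA₁, HasTy.card_proj m x h₁]; simp)
    exact ⟨_, _, B, Cs', by simp only [TyCtx.unbind_add]; abel, rfl, ih₁ _ _ hf₁, ih₂ _ _ hf₂⟩
end

-- Inverse of the preceding lemma: in the derivation of the result, the part that types each `f i`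
-- is cut out and replaced by a declaration of `x` with the type found there.
mutual
theorem HasTy.of_lsub : ∀ (m : ResPre) (x : ℕ) (f : ℕ → ResPre) {Δ : TyCtx} {A : Ty},
    HasTy (ResPre.lsub x f m) Δ A → ∃ (Γ Δ' : TyCtx) (As : List Ty), TyCtx.proj x Γ = As ∧
      Δ = TyCtx.unbind x Γ + Δ' ∧ HasTys ((List.range (deg x m)).map f) Δ' As ∧ HasTy m Γ A
  | var i, x, f, Δ, A, h => by
    refine ⟨TyCtx.single i [A], ?_⟩
    by_cases hx : i = x
    · subst hx
      refine ⟨Δ, [A], TyCtx.proj_single_self _ _, ?_, ?_, rfl⟩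
      · simp [TyCtx.unbind_single_self]
      · simp only [deg, if_true, List.range_one, List.map_cons, List.map_nil, HasTys]
        refine ⟨Δ, 0, A, [], by simp, rfl, ?_, rfl, rfl⟩
        simpa [ResPre.lsub] using h
    · refine ⟨0, [], TyCtx.proj_single_of_ne hx _, ?_, ?_, rfl⟩
      · rw [TyCtx.unbind_single_of_ne hx, add_zero]
        rw [ResPre.lsub, if_neg hx] at h
        split_ifs at h ⊢ <;> exact h
      · simp [deg, hx, HasTys]
  | lam m, x, f, Δ, A, h => by
    obtain ⟨Θ, Cs, B, rfl, hp, rfl, h⟩ := h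
    obtain ⟨Γ, Δ', As, hA, rfl, hf, h'⟩ := HasTy.of_lsub m (x + 1) _ h
    obtain ⟨Δ', rfl, hf'⟩ := HasTys.of_map_rename Nat.succ hf
    refine ⟨TyCtx.unbind 0 Γ, Δ', As, by rw [TyCtx.proj_unbind_zero, hA],
      by simp [TyCtx.unbind_zero_unbind_succ], hf', Γ, Cs, B, rfl, ?_, rfl, h'⟩
    simpa [TyCtx.proj_zero_unbind_succ] using hp
  | app m n, x, f, Δ, A, h => by
    obtain ⟨Γ₁, Γ₂, B, rfl, h₁, h₂⟩ := h
    obtain ⟨Θ₁, Δ₁, As₁, hA₁, rfl, hf₁, h₁'⟩ := HasTy.of_lsub m x _ h₁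
    obtain ⟨Θ₂, Δ₂, As₂, hA₂, rfl, hf₂, h₂'⟩ := HasTy.of_lsub n x _ h₂
    refine ⟨Θ₁ + Θ₂, Δ₁ + Δ₂, As₁ ++ As₂, by simp [hA₁, hA₂], ?_, ?_,
      Θ₁, Θ₂, B, rfl, h₁', h₂'⟩
    · simp only [TyCtx.unbind_add]; abel
    · rw [deg, map_range_add, hasTys_append]
      exact ⟨_, _, _, _, rfl, rfl, hf₁, hf₂⟩
  | der m, x, f, Δ, A, h => HasTy.of_lsub m x f (A := Ty.bag [A]) h
  | es m n, x, f, Δ, A, h => by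
    obtain ⟨Θ, Γ₂, Cs, hp, rfl, h₁, h₂⟩ := h
    obtain ⟨Θ₁, Δ₁, As₁, hA₁, rfl, hf₁, h₁'⟩ := HasTy.of_lsub m (x + 1) _ h₁
    obtain ⟨Θ₂, Δ₂, As₂, hA₂, rfl, hf₂, h₂'⟩ := HasTy.of_lsub n x _ h₂
    obtain ⟨Δ₁, rfl, hf₁'⟩ := HasTys.of_map_rename Nat.succ hf₁
    refine ⟨TyCtx.unbind 0 Θ₁ + Θ₂, Δ₁ + Δ₂, As₁ ++ As₂,
      by simp [TyCtx.proj_unbind_zero, hA₁, hA₂], ?_, ?_, Θ₁, Θ₂, Cs, ?_, rfl, h₁', h₂'⟩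
    · simp only [TyCtx.unbind_add, TyCtx.unbind_zero_unbind_succ, TyCtx.unbind_zero_ren_nat_succ]
      abel
    · rw [deg, map_range_add, hasTys_append]
      exact ⟨_, _, _, _, rfl, rfl, hf₁', hf₂⟩
    · simpa [TyCtx.proj_zero_unbind_succ] using hp
  | bag ms, x, f, Δ, A, h => by
    obtain ⟨Cs, Bs, rfl, hp, h⟩ := h
    obtain ⟨Γ, Δ', As, hA, rfl, hf, h'⟩ := HasTys.of_lsub ms x f h
    exact ⟨Γ, Δ', As, hA, rfl, hf, Cs, Bs, rfl, hp, h'⟩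
theorem HasTys.of_lsub : ∀ (ms : List ResPre) (x : ℕ) (f : ℕ → ResPre) {Δ : TyCtx}
    {Cs : List Ty}, HasTys (lsubList x f ms) Δ Cs →
    ∃ (Γ Δ' : TyCtx) (As : List Ty), TyCtx.proj x Γ = As ∧ Δ = TyCtx.unbind x Γ + Δ' ∧
      HasTys ((List.range (degList x ms)).map f) Δ' As ∧ HasTys ms Γ Cs
  | [], x, f, Δ, Cs, h => by
    obtain ⟨rfl, rfl⟩ := h
    exact ⟨0, 0, [], rfl, rfl, ⟨rfl, rfl⟩, rfl, rfl⟩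
  | m :: ms, x, f, Δ, Cs, h => by
    obtain ⟨Γ₁, Γ₂, B, Cs', rfl, rfl, h₁, h₂⟩ := h
    obtain ⟨Θ₁, Δ₁, As₁, hA₁, rfl, hf₁, h₁'⟩ := HasTy.of_lsub m x _ h₁
    obtain ⟨Θ₂, Δ₂, As₂, hA₂, rfl, hf₂, h₂'⟩ := HasTys.of_lsub ms x _ h₂
    refine ⟨Θ₁ + Θ₂, Δ₁ + Δ₂, As₁ ++ As₂, by simp [hA₁, hA₂], ?_, ?_,
      Θ₁, Θ₂, B, Cs', rfl, rfl, h₁', h₂'⟩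
    · simp only [TyCtx.unbind_add]; abel
    · rw [degList, map_range_add, hasTys_append]
      exact ⟨_, _, _, _, rfl, rfl, hf₁, hf₂⟩
end

theorem map_range_getD {α : Type*} (l : List α) (d : α) :
    (List.range l.length).map (fun i => l.getD i d) = l := by
  apply List.ext_getElem
  · simp
  · intro i h₁ h₂
    simp [h₂]

theorem hasTy_plugL (l : List ResPre) : ∀ {m : ResPre} {Γ : TyCtx} {A : Ty},
    HasTy (plugL l m) Γ A ↔ ∃ Θ, TyCtx.ListTy (l.map HasTy) Θ Γ ∧ HasTy m Θ A := by
  induction l with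
  | nil =>
    intro m Γ A
    exact ⟨fun h => ⟨Γ, rfl, h⟩, by rintro ⟨_, rfl, h⟩; exact h⟩
  | cons n l ih =>
    intro m Γ A
    rw [plugL, ih]
    constructor
    · rintro ⟨_, hl, Θ, Δ, As, hp, rfl, h₁, h₂⟩
      exact ⟨Θ, ⟨Δ, As, hp, h₂, hl⟩, h₁⟩
    · rintro ⟨Θ, ⟨Δ, As, hp, h₂, hl⟩, h₁⟩
      exact ⟨_, hl, Θ, Δ, As, hp, rfl, h₁, h₂⟩

-- Subject reduction and expansion for resource terms

theorem hasTy_beta {l : List ResPre} {m n : ResPre} {Γ : TyCtx} {B : Ty} :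
    HasTy (app (plugL l (lam m)) n) Γ B ↔
      HasTy (plugL l (es m (ResPre.rename (fun j => j + l.length) n))) Γ B := by
  rw [hasTy_plugL]
  constructor
  · rintro ⟨Γ₁, Γ₂, A, rfl, h₁, h₂⟩
    obtain ⟨_, hl, Θ, As, B, he, hp, rfl, h₁⟩ := (hasTy_plugL l).1 h₁
    cases he
    exact ⟨_, (TyCtx.listTy_add (List.length_map _)).2 ⟨Γ₁, rfl, hl⟩, Θ, _, As, hp, rfl, h₁, HasTy.rename _ n h₂⟩
  · rintro ⟨_, hl, Θ, Δ, As, hp, rfl, h₁, h₂⟩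
    obtain ⟨Δ, rfl, h₂'⟩ := HasTy.of_rename _ n h₂
    obtain ⟨Γ₁, rfl, hl'⟩ := (TyCtx.listTy_add (List.length_map _)).1 hl
    exact ⟨Γ₁, Δ, _, rfl, (hasTy_plugL l).2 ⟨_, hl', Θ, As, B, rfl, hp, rfl, h₁⟩, h₂'⟩

/-- The occurrences of `x` and the elements of the bag have the same types up to order, so the
numbers agree, and matching types gives a permutation for which the typing survives. Other
permutations may destroy it. -/
theorem HasTy.exists_sub {l : List ResPre} {m : ResPre} {ps : List ResPre} {Γ : TyCtx} {B : Ty}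
    (h : HasTy (es m (plugL l (bag ps))) Γ B) : deg 0 m = ps.length ∧ ∃ qs, qs.Perm ps ∧
      HasTy (plugL l (linst (ResPre.rename (liftRen (fun j => j + l.length)) m) qs)) Γ B := by
  obtain ⟨Θ, Δ, As, hp, rfl, h₁, h₂⟩ := h
  obtain ⟨Ψ, hl, As', Bs, he, hperm, h₂⟩ := (hasTy_plugL l).1 h₂
  cases he
  have hdeg : deg 0 m = ps.length := by
    rw [← HasTy.card_proj m 0 h₁, hp, ← h₂.length, hperm.length_eq, Multiset.coe_card]
  refine ⟨hdeg, ?_⟩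
  have h₁' := HasTy.rename (liftRen (fun j => j + l.length)) m h₁
  obtain ⟨Cs, hC, ih⟩ := HasTy.lsub _ 0 h₁'
  rw [TyCtx.proj_zero_ren_liftRen, hp, Multiset.coe_eq_coe] at hC
  obtain ⟨qs, hq, h₂'⟩ := HasTys.perm_types (hperm.trans hC) h₂
  refine ⟨qs, hq, (hasTy_plugL l).2 ⟨_, ?_, ih _ Ψ ?_⟩⟩
  · rw [TyCtx.unbind_zero_ren_liftRen, add_comm, TyCtx.listTy_add (List.length_map _), add_comm]
    exact ⟨_, rfl, hl⟩
  · have : deg 0 (ResPre.rename (liftRen fun j => j + l.length) m) = qs.length := by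
      rw [← HasTy.card_proj _ 0 h₁', TyCtx.proj_zero_ren_liftRen, HasTy.card_proj m 0 h₁, hdeg,
        hq.length_eq]
    rwa [this, map_range_getD]

/-- Expansion works for every permutation, because a bag is typed up to reordering. -/
theorem HasTy.of_sub {l : List ResPre} {m : ResPre} {ps qs : List ResPre} {Γ : TyCtx} {B : Ty}
    (hd : deg 0 m = ps.length) (hq : qs.Perm ps)
    (h : HasTy (plugL l (linst (ResPre.rename (liftRen (fun j => j + l.length)) m) qs)) Γ B) :
    HasTy (es m (plugL l (bag ps))) Γ B := by
  obtain ⟨Θ, hl, h⟩ := (hasTy_plugL l).1 h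
  obtain ⟨Θ', Ψ, As, hp, rfl, hf, h'⟩ := HasTy.of_lsub _ _ _ h
  obtain ⟨Θ, rfl, h''⟩ := HasTy.of_rename _ m h'
  rw [← HasTy.card_proj _ 0 h', TyCtx.proj_zero_ren_liftRen, HasTy.card_proj m 0 h'', hd,
    ← hq.length_eq, map_range_getD] at hf
  rw [TyCtx.unbind_zero_ren_liftRen, add_comm, TyCtx.listTy_add (List.length_map _)] at hl
  obtain ⟨Γ, rfl, hl'⟩ := hl
  obtain ⟨Bs, hB, hf'⟩ := hf.perm_terms hq
  exact ⟨Θ, Γ, As, by rwa [TyCtx.proj_zero_ren_liftRen] at hp, add_comm _ _, h'',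
    (hasTy_plugL l).2 ⟨Ψ, hl', Bs, As, rfl, hB, hf'⟩⟩

theorem hasTy_bag_singleton {m : ResPre} {Γ : TyCtx} {A : Ty} :
    HasTy (bag [m]) Γ (Ty.bag [A]) ↔ HasTy m Γ A := by
  constructor
  · rintro ⟨As, Bs, he, hp, Γ₁, Γ₂, A, As', rfl, rfl, h, rfl, rfl⟩
    cases he
    cases List.perm_singleton.1 hp
    simpa using h
  · intro h
    exact ⟨[A], [A], rfl, .refl _, Γ, 0, A, [], by simp, rfl, h, rfl, rfl⟩

theorem hasTy_der_plugL {l : List ResPre} {m : ResPre} {Γ : TyCtx} {A : Ty} :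
    HasTy (der (plugL l (bag [m]))) Γ A ↔ HasTy (plugL l m) Γ A := by
  rw [HasTy, hasTy_plugL, hasTy_plugL]
  simp only [hasTy_bag_singleton]

theorem Step.hasTy_of_hasTy {m : ResPre} {r : Option ResPre} (h : Step m r) :
    ∀ {m' : ResPre}, r = some m' → ∀ {Γ : TyCtx} {A : Ty}, HasTy m' Γ A → HasTy m Γ A := by
  induction h with
  | beta l m n => rintro _ ⟨⟩ Γ A h; exact hasTy_beta.2 h
  | sub l m ps qs hd hq => rintro _ ⟨⟩ Γ A h; exact h.of_sub hd hq
  | subZero | derZero => rintro _ ⟨⟩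
  | der l m => rintro _ ⟨⟩ Γ A h; exact hasTy_der_plugL.2 h
  | @lamCtx m r _ ih =>
    rcases r with _ | m' <;> rintro _ ⟨⟩ Γ A ⟨Θ, As, B, hT, hp, hu, h⟩
    exact ⟨Θ, As, B, hT, hp, hu, ih rfl h⟩
  | @appL m r n _ ih =>
    rcases r with _ | m' <;> rintro _ ⟨⟩ Γ A ⟨Γ₁, Γ₂, A, he, h₁, h₂⟩
    exact ⟨Γ₁, Γ₂, A, he, ih rfl h₁, h₂⟩
  | @appR m n r _ ih =>
    rcases r with _ | m' <;> rintro _ ⟨⟩ Γ A ⟨Γ₁, Γ₂, A, he, h₁, h₂⟩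
    exact ⟨Γ₁, Γ₂, A, he, h₁, ih rfl h₂⟩
  | @derCtx m r _ ih =>
    rcases r with _ | m' <;> rintro _ ⟨⟩ Γ A h
    exact ih (A := Ty.bag [A]) rfl h
  | @esL m r n _ ih =>
    rcases r with _ | m' <;> rintro _ ⟨⟩ Γ A ⟨Θ, Δ, As, hp, he, h₁, h₂⟩
    exact ⟨Θ, Δ, As, hp, he, ih rfl h₁, h₂⟩
  | @esR m n r _ ih =>
    rcases r with _ | m' <;> rintro _ ⟨⟩ Γ A ⟨Θ, Δ, As, hp, he, h₁, h₂⟩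
    exact ⟨Θ, Δ, As, hp, he, h₁, ih rfl h₂⟩
  | @bagCtx as bs m r _ ih =>
    rcases r with _ | m' <;> rintro _ ⟨⟩ Γ A ⟨As, Bs, he, hp, h⟩
    obtain ⟨Γ₁, Γ₂, As₁, As₂, rfl, rfl, h₁, Γ₃, Γ₄, A, As₃, rfl, rfl, h₂, h₃⟩ :=
      hasTys_append.1 h
    exact ⟨_, Bs, he, hp, hasTys_append.2 ⟨Γ₁, _, As₁, _, rfl, rfl, h₁, Γ₃, Γ₄, A, As₃, rfl, rfl,
      ih rfl h₂, h₃⟩⟩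

/-- The given step only locates a redex, possibly one that yields `∅`. Every subterm of a typable
term is typed in the derivation, so that redex can be fired in a way that preserves the typing. -/
theorem Step.exists_hasTy {m : ResPre} {r : Option ResPre} (h : Step m r) :
    ∀ {Γ : TyCtx} {A : Ty}, HasTy m Γ A → ∃ m', Step m (some m') ∧ HasTy m' Γ A := by
  induction h with
  | beta l m n => intro Γ A h; exact ⟨_, .beta l m n, hasTy_beta.1 h⟩
  | sub l m ps _ _ _ | subZero l m ps _ =>
    intro Γ A h
    obtain ⟨hd, qs, hq, h'⟩ := h.exists_sub
    exact ⟨_, .sub l m ps qs hd hq, h'⟩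
  | der l m => intro Γ A h; exact ⟨_, .der l m, hasTy_der_plugL.1 h⟩
  | derZero l ms hk =>
    intro Γ A h
    obtain ⟨Θ, -, As, Bs, he, hp, h⟩ := (hasTy_plugL l).1 (show HasTy _ Γ (Ty.bag [A]) from h)
    cases he
    exact absurd (h.length.symm.trans hp.length_eq) hk
  | lamCtx _ ih =>
    rintro Γ A ⟨Θ, As, B, hT, hp, hu, h⟩
    obtain ⟨m', hs, h'⟩ := ih h
    exact ⟨_, .lamCtx hs, Θ, As, B, hT, hp, hu, h'⟩
  | appL n _ ih =>
    rintro Γ A ⟨Γ₁, Γ₂, A, he, h₁, h₂⟩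
    obtain ⟨m', hs, h'⟩ := ih h₁
    exact ⟨_, .appL n hs, Γ₁, Γ₂, A, he, h', h₂⟩
  | appR m _ ih =>
    rintro Γ A ⟨Γ₁, Γ₂, A, he, h₁, h₂⟩
    obtain ⟨m', hs, h'⟩ := ih h₂
    exact ⟨_, .appR m hs, Γ₁, Γ₂, A, he, h₁, h'⟩
  | derCtx _ ih =>
    intro Γ A h
    obtain ⟨m', hs, h'⟩ := ih (A := Ty.bag [A]) h
    exact ⟨_, .derCtx hs, h'⟩
  | esL n _ ih =>
    rintro Γ A ⟨Θ, Δ, As, hp, he, h₁, h₂⟩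
    obtain ⟨m', hs, h'⟩ := ih h₁
    exact ⟨_, .esL n hs, Θ, Δ, As, hp, he, h', h₂⟩
  | esR m _ ih =>
    rintro Γ A ⟨Θ, Δ, As, hp, he, h₁, h₂⟩
    obtain ⟨m', hs, h'⟩ := ih h₂
    exact ⟨_, .esR m hs, Θ, Δ, As, hp, he, h₁, h'⟩
  | bagCtx as bs _ ih =>
    rintro Γ A ⟨As, Bs, he, hp, h⟩
    obtain ⟨Γ₁, Γ₂, As₁, As₂, rfl, rfl, h₁, Γ₃, Γ₄, A, As₃, rfl, rfl, h₂, h₃⟩ :=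
      hasTys_append.1 h
    obtain ⟨m', hs, h'⟩ := ih h₂
    exact ⟨_, .bagCtx as bs hs, _, Bs, he, hp, hasTys_append.2 ⟨Γ₁, _, As₁, _, rfl, rfl, h₁,
      Γ₃, Γ₄, A, As₃, rfl, rfl, h', h₃⟩⟩

theorem PermEq.hasTy_iff {m n : ResPre} (h : PermEq m n) :
    ∀ {Γ : TyCtx} {A : Ty}, HasTy m Γ A ↔ HasTy n Γ A := by
  induction h with
  | refl m => exact Iff.rfl
  | symm _ ih => exact ih.symm
  | trans _ _ ih₁ ih₂ => exact ih₁.trans ih₂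
  | @perm ms ns hp =>
    have key : ∀ {ms ns : List ResPre}, ms.Perm ns → ∀ {Γ A}, HasTy (.bag ms) Γ A →
        HasTy (.bag ns) Γ A := by
      rintro ms ns hp Γ A ⟨As, Bs, he, hA, h⟩
      obtain ⟨Cs, hC, h'⟩ := h.perm_terms hp
      exact ⟨Cs, Bs, he, hC.trans hA, h'⟩
    exact fun {Γ A} => ⟨key hp, key hp.symm⟩
  | lam _ ih => intro Γ A; simp only [HasTy, ih]
  | app _ _ ih₁ ih₂ => intro Γ A; simp only [HasTy, ih₁, ih₂]
  | der _ ih => intro Γ A; simp only [HasTy, ih]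
  | es _ _ ih₁ ih₂ => intro Γ A; simp only [HasTy, ih₁, ih₂]
  | bag as bs _ ih => intro Γ A; simp only [HasTy, hasTys_append, HasTys, ih]

/-! ### Sizes -/

mutual
/-- The number of constructors, where variables and bags are not counted. -/
def size : ResPre → ℕ
  | var _ => 0
  | lam m => size m + 1
  | app m n => size m + size n + 1
  | der m => size m + 1
  | es m n => size m + size n + 1
  | bag ms => sizeList ms
/-- The sum of the sizes of the elements of a list. -/
def sizeList : List ResPre → ℕ
  | [] => 0
  | m :: ms => size m + sizeList ms
end

theorem sizeList_eq (ms : List ResPre) : sizeList ms = (ms.map size).sum := by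
  induction ms with
  | nil => rfl
  | cons m ms ih => simp [sizeList, ih]

theorem sizeList_append (ms ns : List ResPre) :
    sizeList (ms ++ ns) = sizeList ms + sizeList ns := by
  simp [sizeList_eq]

mutual
theorem size_rename (ρ : ℕ → ℕ) : ∀ m : ResPre, size (rename ρ m) = size m
  | var i => rfl
  | lam m => by simp [rename, size, size_rename _ m]
  | app m n => by simp [rename, size, size_rename ρ m, size_rename ρ n]
  | der m => by simp [rename, size, size_rename ρ m]
  | es m n => by simp [rename, size, size_rename _ m, size_rename ρ n]
  | bag ms => sizeList_renameList ρ ms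
theorem sizeList_renameList (ρ : ℕ → ℕ) : ∀ ms : List ResPre,
    sizeList (renameList ρ ms) = sizeList ms
  | [] => rfl
  | m :: ms => by simp [renameList, sizeList, size_rename ρ m, sizeList_renameList ρ ms]
end

-- Since variables and bags weigh nothing, filling the occurrences adds exactly the sizes of the
-- substituted terms.
mutual
theorem size_lsub : ∀ (m : ResPre) (x : ℕ) (f : ℕ → ResPre),
    size (lsub x f m) = size m + sizeList ((List.range (deg x m)).map f)
  | var i, x, f => by
    by_cases hx : i = x
    · simp [lsub, deg, hx, size, sizeList]
    · rw [lsub, if_neg hx, deg, if_neg hx]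
      split_ifs <;> rfl
  | lam m, x, f => by
    simp only [lsub, deg, size, size_lsub m, sizeList_eq, List.map_map, Function.comp_def,
      size_rename]
    omega
  | app m n, x, f => by
    simp only [lsub, deg, size, size_lsub m, size_lsub n, map_range_add, sizeList_eq,
      List.map_append, List.sum_append]
    omega
  | der m, x, f => by
    simp only [lsub, deg, size, size_lsub m]
    omega
  | es m n, x, f => by
    simp only [lsub, deg, size, size_lsub m, size_lsub n, map_range_add, sizeList_eq,
      List.map_append, List.sum_append, List.map_map, Function.comp_def, size_rename]
    omega
  | bag ms, x, f => sizeList_lsubList ms x f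
theorem sizeList_lsubList : ∀ (ms : List ResPre) (x : ℕ) (f : ℕ → ResPre),
    sizeList (lsubList x f ms) = sizeList ms + sizeList ((List.range (degList x ms)).map f)
  | [], x, f => rfl
  | m :: ms, x, f => by
    simp only [lsubList, degList, sizeList, size_lsub m, sizeList_lsubList ms, map_range_add,
      sizeList_append]
    omega
end

-- The iterated lifting fixes the indices up to `x` and keeps the others above `x`. The iterate is
-- what the induction meets below binders.
mutual
theorem deg_rename_liftRen (ρ : ℕ → ℕ) : ∀ (m : ResPre) (x : ℕ),
    deg x (rename (liftRen^[x + 1] ρ) m) = deg x m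
  | var i, x => by
    have key : ∀ x i, (liftRen^[x + 1] ρ) i = x ↔ i = x := by
      intro x
      induction x with
      | zero => intro i; cases i <;> simp [liftRen]
      | succ x ih =>
        intro i
        rw [Function.iterate_succ_apply']
        cases i with
        | zero => simp [liftRen]
        | succ i => simpa [liftRen] using ih i
    simp only [rename, deg, key]
  | lam m, x => by
    have := deg_rename_liftRen ρ m (x + 1)
    rw [Function.iterate_succ_apply'] at this
    simpa [rename, deg] using this
  | app m n, x => by
    simp only [rename, deg, deg_rename_liftRen ρ m, deg_rename_liftRen ρ n]
  | der m, x => deg_rename_liftRen ρ m x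
  | es m n, x => by
    have := deg_rename_liftRen ρ m (x + 1)
    rw [Function.iterate_succ_apply'] at this
    simp only [rename, deg, this, deg_rename_liftRen ρ n]
  | bag ms, x => degList_renameList_liftRen ρ ms x
theorem degList_renameList_liftRen (ρ : ℕ → ℕ) : ∀ (ms : List ResPre) (x : ℕ),
    degList x (renameList (liftRen^[x + 1] ρ) ms) = degList x ms
  | [], x => rfl
  | m :: ms, x => by
    simp only [renameList, degList, deg_rename_liftRen ρ m, degList_renameList_liftRen ρ ms]
end

theorem size_plugL (l : List ResPre) : ∀ m : ResPre,
    size (plugL l m) = size m + sizeList l + l.length := by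
  induction l with
  | nil => intro m; rfl
  | cons n l ih => intro m; simp only [plugL, ih, size, sizeList, List.length_cons]; omega

/-- Nothing is duplicated, and each rule removes a counted constructor: an application and an
abstraction become one explicit substitution, and the other rules remove an explicit substitution or
a `der`. -/
theorem Step.size_lt {m : ResPre} {r : Option ResPre} (h : Step m r) :
    ∀ {m' : ResPre}, r = some m' → size m' < size m := by
  induction h with
  | beta l m n => rintro _ ⟨⟩; simp only [size, size_plugL, size_rename]; omega
  | sub l m ps qs hd hq =>
    rintro _ ⟨⟩
    have h₁ : deg 0 (rename (liftRen fun j => j + l.length) m) = qs.length :=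
      (deg_rename_liftRen _ m 0).trans (hd.trans hq.length_eq.symm)
    have h₂ : sizeList qs = sizeList ps := by
      rw [sizeList_eq, sizeList_eq, (hq.map size).sum_eq]
    simp only [size, size_plugL, linst, size_lsub, size_rename, h₁, map_range_getD, h₂]
    omega
  | subZero | derZero => rintro _ ⟨⟩
  | der l m => rintro _ ⟨⟩; simp only [size, size_plugL, sizeList]; omega
  | @lamCtx m r _ ih | @appL m r _ _ ih | @appR _ m r _ ih | @derCtx m r _ ih | @esL m r _ _ ih
  | @esR _ m r _ ih | @bagCtx _ _ m r _ ih =>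
    rcases r with _ | m' <;> rintro _ ⟨⟩
    have := ih rfl
    simp only [size, sizeList_eq, List.map_append, List.map_cons, List.sum_append, List.sum_cons]
    omega

theorem PermEq.size_eq {m n : ResPre} (h : PermEq m n) : size m = size n := by
  induction h with
  | refl => rfl
  | symm _ ih => exact ih.symm
  | trans _ _ ih₁ ih₂ => exact ih₁.trans ih₂
  | perm hp => simp only [size, sizeList_eq, (hp.map size).sum_eq]
  | lam _ ih | der _ ih => simp only [size, ih]
  | app _ _ ih₁ ih₂ | es _ _ ih₁ ih₂ => simp only [size, ih₁, ih₂]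
  | bag as bs _ ih => simp [size, sizeList_eq, ih]

/-- Induction on the size, following typable reducts. The redex may be visible only in another
representative, to which the typing is moved first. -/
theorem HasTy.exists_isNormalFormOf {m : ResPre} {Γ : TyCtx} {A : Ty} (h : HasTy m Γ A) :
    ∃ u, ResTerm.IsNormalFormOf u (ResTerm.mk m) := by
  induction hk : size m using Nat.strong_induction_on generalizing m with
  | _ k ih =>
    by_cases hn : ResTerm.IsNormal (ResTerm.mk m)
    · exact ⟨_, .refl, hn⟩
    · simp only [ResTerm.IsNormal, not_forall, not_not] at hn
      obtain ⟨_, m₀, r, hm, rfl, hs⟩ := hn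
      have hm' : PermEq m₀ m := Quotient.exact hm
      obtain ⟨m', hs', h'⟩ := hs.exists_hasTy (hm'.hasTy_iff.2 h)
      obtain ⟨u, hu, hn⟩ := ih _ (hk ▸ hm'.size_eq ▸ hs'.size_lt rfl) h' rfl
      exact ⟨u, .head ⟨m₀, _, hm, rfl, hs'⟩ hu, hn⟩

theorem hasTy_of_reflTransGen {t u : ResTerm}
    (h : Relation.ReflTransGen (fun a b => ResTerm.Step a (some b)) t u) {p : ResPre}
    (hp : ResTerm.mk p = u) {Γ : TyCtx} {A : Ty} (hA : HasTy p Γ A) :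
    ∀ {m : ResPre}, ResTerm.mk m = t → HasTy m Γ A := by
  induction h using Relation.ReflTransGen.head_induction_on with
  | refl =>
    intro m hm
    exact (PermEq.hasTy_iff (Quotient.exact (hm.trans hp.symm))).2 hA
  | head hs _ ih =>
    intro m hm
    obtain ⟨m₀, r, hm₀, hr, hs⟩ := hs
    rcases r with _ | m' <;> simp at hr
    exact (PermEq.hasTy_iff (Quotient.exact (hm.trans hm₀.symm))).2
      (hs.hasTy_of_hasTy rfl (ih hr))

end ResPre

namespace ResPre

/-! ### Sorts -/

mutual
/-- The two sorts of the terms in the target of the Taylor expansion: `true` is the sort of bags,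
`false` is the sort of their elements. -/
def IsSort : Bool → ResPre → Prop
  | b, var _ => b = false
  | b, lam m => b = false ∧ IsSort true m
  | b, app m n => b = true ∧ IsSort false m ∧ IsSort true n
  | b, der m => b = false ∧ IsSort true m
  | b, es m n => IsSort b m ∧ IsSort true n
  | b, bag ms => b = true ∧ AllElem ms
/-- All elements of the list have the sort `false`. -/
def AllElem : List ResPre → Prop
  | [] => True
  | m :: ms => IsSort false m ∧ AllElem ms
end

theorem allElem_iff {ms : List ResPre} : AllElem ms ↔ ∀ m ∈ ms, IsSort false m := by
  induction ms with
  | nil => simp [AllElem]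
  | cons m ms ih => simp [AllElem, ih]

theorem allElem_append {ms ns : List ResPre} :
    AllElem (ms ++ ns) ↔ AllElem ms ∧ AllElem ns := by
  simp [allElem_iff, or_imp, forall_and]

mutual
theorem isSort_rename (ρ : ℕ → ℕ) : ∀ (m : ResPre) (b : Bool), IsSort b (rename ρ m) ↔ IsSort b m
  | var i, b => Iff.rfl
  | lam m, b => by simp only [rename, IsSort, isSort_rename _ m]
  | app m n, b => by simp only [rename, IsSort, isSort_rename ρ m, isSort_rename ρ n]
  | der m, b => by simp only [rename, IsSort, isSort_rename ρ m]
  | es m n, b => by simp only [rename, IsSort, isSort_rename _ m, isSort_rename ρ n]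
  | bag ms, b => by simp only [rename, IsSort, allElem_renameList ρ ms]
theorem allElem_renameList (ρ : ℕ → ℕ) : ∀ ms : List ResPre,
    AllElem (renameList ρ ms) ↔ AllElem ms
  | [] => Iff.rfl
  | m :: ms => by simp only [renameList, AllElem, isSort_rename ρ m, allElem_renameList ρ ms]
end

mutual
theorem IsSort.lsub : ∀ (m : ResPre) {b : Bool} (x : ℕ) {f : ℕ → ResPre},
    (∀ i, IsSort false (f i)) → IsSort b m → IsSort b (ResPre.lsub x f m)
  | var i, b, x, f, hf, h => by
    cases h
    rw [ResPre.lsub]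
    split_ifs
    exacts [hf 0, rfl, rfl]
  | lam m, b, x, f, hf, h =>
    ⟨h.1, IsSort.lsub m _ (fun i => (isSort_rename _ _ _).2 (hf i)) h.2⟩
  | app m n, b, x, f, hf, h =>
    ⟨h.1, IsSort.lsub m x hf h.2.1, IsSort.lsub n x (fun _ => hf _) h.2.2⟩
  | der m, b, x, f, hf, h => ⟨h.1, IsSort.lsub m x hf h.2⟩
  | es m n, b, x, f, hf, h =>
    ⟨IsSort.lsub m _ (fun i => (isSort_rename _ _ _).2 (hf i)) h.1,
      IsSort.lsub n x (fun _ => hf _) h.2⟩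
  | bag ms, b, x, f, hf, h => ⟨h.1, AllElem.lsub ms x hf h.2⟩
theorem AllElem.lsub : ∀ (ms : List ResPre) (x : ℕ) {f : ℕ → ResPre},
    (∀ j, IsSort false (f j)) → AllElem ms → AllElem (lsubList x f ms)
  | [], _, _, _, _ => trivial
  | m :: ms, x, f, hf, h => ⟨IsSort.lsub m x hf h.1, AllElem.lsub ms x (fun _ => hf _) h.2⟩
end

theorem isSort_plugL {b : Bool} (l : List ResPre) : ∀ {m : ResPre},
    IsSort b (plugL l m) ↔ IsSort b m ∧ ∀ n ∈ l, IsSort true n := by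
  induction l with
  | nil => simp [plugL]
  | cons n l ih => intro m; simp [plugL, ih, IsSort, and_assoc]

theorem Step.isSort {m : ResPre} {r : Option ResPre} (h : Step m r) :
    ∀ {m' : ResPre}, r = some m' → ∀ {b : Bool}, IsSort b m → IsSort b m' := by
  induction h with
  | beta l m n =>
    rintro _ ⟨⟩ b h
    simp_all [IsSort, isSort_plugL, isSort_rename]
  | sub l m ps qs hd hq =>
    rintro _ ⟨⟩ b ⟨h₁, h₂⟩
    obtain ⟨⟨-, h₂⟩, h₃⟩ := (isSort_plugL l).1 h₂
    refine (isSort_plugL l).2 ⟨IsSort.lsub _ 0 (fun i => ?_) ((isSort_rename _ _ _).2 h₁), h₃⟩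
    by_cases hi : i < qs.length
    · rw [List.getD_eq_getElem _ _ hi]
      exact allElem_iff.1 h₂ _ (hq.subset (List.getElem_mem hi))
    -- The default `var 0` also has the sort of elements, so indices out of range do no harm.
    · rw [List.getD_eq_default _ _ (not_lt.1 hi)]
      rfl
  | subZero | derZero => rintro _ ⟨⟩
  | der l m =>
    rintro _ ⟨⟩ b h
    simp_all [IsSort, isSort_plugL, AllElem]
  | @lamCtx m r _ ih | @appL m r _ _ ih | @appR _ m r _ ih | @derCtx m r _ ih | @esL m r _ _ ih
  | @esR _ m r _ ih | @bagCtx _ _ m r _ ih =>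
    rcases r with _ | m' <;> rintro _ ⟨⟩ b h
    have ih := @ih _ rfl
    simp only [IsSort, allElem_append, AllElem] at h ⊢
    grind

theorem PermEq.isSort_iff {m n : ResPre} (h : PermEq m n) :
    ∀ {b : Bool}, IsSort b m ↔ IsSort b n := by
  induction h with
  | refl => exact Iff.rfl
  | symm _ ih => exact ih.symm
  | trans _ _ ih₁ ih₂ => exact ih₁.trans ih₂
  | perm hp => intro b; simp only [IsSort, allElem_iff, hp.mem_iff]
  | lam _ ih | der _ ih => intro b; simp only [IsSort, ih]
  | app _ _ ih₁ ih₂ | es _ _ ih₁ ih₂ => intro b; simp only [IsSort, ih₁, ih₂]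
  | bag as bs _ ih => intro b; simp only [IsSort, allElem_append, AllElem, ih]

theorem ApproxV.isSort {m : ResPre} {M : VTerm} (h : ApproxV m M) : IsSort true m := by
  induction h with
  | var k i => simp [IsSort, allElem_iff]
  | lam ms M _ ih =>
    refine ⟨rfl, allElem_iff.2 fun _ hm => ?_⟩
    obtain ⟨m, hm', rfl⟩ := List.mem_map.1 hm
    exact ⟨rfl, ih m hm'⟩
  | appDer _ _ _ ih₁ ih₂ => exact ⟨rfl, ⟨rfl, ih₁⟩, ih₂⟩
  | appVal _ _ _ ih₁ ih₂ => exact ⟨rfl, ih₁.2.1, ih₂⟩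
  | es _ _ ih₁ ih₂ => exact ⟨ih₁, ih₂⟩

theorem exists_isSort_of_reflTransGen {t u : ResTerm}
    (h : Relation.ReflTransGen (fun a b => ResTerm.Step a (some b)) t u) {b : Bool}
    {m : ResPre} (hm : ResTerm.mk m = t) (hb : IsSort b m) :
    ∃ p, ResTerm.mk p = u ∧ IsSort b p := by
  induction h with
  | refl => exact ⟨m, hm, hb⟩
  | tail _ hs ih =>
    obtain ⟨p, hp, hb⟩ := ih
    obtain ⟨m₀, r, hm₀, hr, hs⟩ := hs
    rcases r with _ | m' <;> simp at hr
    exact ⟨m', hr, hs.isSort rfl ((PermEq.isSort_iff (Quotient.exact (hm₀.trans hp.symm))).2 hb)⟩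

/-! ### Normal terms are typable -/

/-- No rule applies to the representative `m`. -/
def Normal (m : ResPre) : Prop := ∀ r, ¬ Step m r

/-- The terms `l⟨λx m⟩` and `l⟨[m₁, …, mₖ]⟩`. -/
def IsAnswer : Bool → ResPre → Prop
  | false, m => ∃ l p, m = plugL l (lam p)
  | true, m => ∃ l ps, m = plugL l (bag ps)

theorem plugL_append (l : List ResPre) : ∀ (k : List ResPre) (m : ResPre),
    plugL (l ++ k) m = plugL k (plugL l m) := by
  induction l with
  | nil => intro k m; rfl
  | cons n l ih => intro k m; exact ih k _

theorem IsAnswer.es {b : Bool} {m : ResPre} (h : IsAnswer b m) (n : ResPre) :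
    IsAnswer b (es m n) := by
  cases b <;> obtain ⟨l, p, rfl⟩ := h <;> exact ⟨l ++ [n], p, by rw [plugL_append]; rfl⟩

/-- `m` is typable, and if it is not an answer it has every type. -/
def Typable (b : Bool) (m : ResPre) : Prop :=
  (∃ Γ A, HasTy m Γ A) ∧ (IsAnswer b m ∨ ∀ A, ∃ Γ, HasTy m Γ A)

-- The second half of `Typable` drives the induction. Were the function, the argument of `der` or
-- the content of an explicit substitution an answer, its sort would make it an answer of the
-- matching kind, and a rule, possibly to `∅`, would apply. So it is stuck on a variable and takes
-- whatever type its surroundings require.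
mutual
theorem Normal.typable : ∀ (m : ResPre) {b : Bool}, Normal m → IsSort b m → Typable b m
  | var i, b, hn, hs =>
    ⟨⟨_, Ty.bag [], rfl⟩, Or.inr fun A => ⟨_, rfl⟩⟩
  | lam m, b, hn, hs => by
    obtain ⟨rfl, hs⟩ := hs
    obtain ⟨⟨Γ, A, h⟩, -⟩ := Normal.typable m (fun r hr => hn _ (.lamCtx hr)) hs
    obtain ⟨As, hA⟩ := Quot.exists_rep (TyCtx.proj 0 Γ)
    exact ⟨⟨_, _, Γ, As, A, rfl, hA.symm, rfl, h⟩, Or.inl ⟨[], m, rfl⟩⟩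
  | app m n, b, hn, hs => by
    obtain ⟨rfl, hm, hn'⟩ := hs
    obtain ⟨⟨Δ, A, h₂⟩, -⟩ := Normal.typable n (fun r hr => hn _ (.appR m hr)) hn'
    obtain ⟨-, ⟨l, p, rfl⟩ | h₁⟩ := Normal.typable m (fun r hr => hn _ (.appL n hr)) hm
    · exact absurd (.beta l p n) (hn _)
    · have key : ∀ B, ∃ Γ, HasTy (app m n) Γ B := fun B =>
        (h₁ (Ty.arr A B)).elim fun Γ h => ⟨Γ + Δ, Γ, Δ, A, rfl, h, h₂⟩
      exact ⟨(key (Ty.bag [])).imp fun Γ h => ⟨_, h⟩, Or.inr key⟩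
  | der m, b, hn, hs => by
    obtain ⟨rfl, hs⟩ := hs
    obtain ⟨-, ⟨l, ps, rfl⟩ | h₁⟩ := Normal.typable m (fun r hr => hn _ (.derCtx hr)) hs
    · by_cases hk : ps.length = 1
      · obtain ⟨p, rfl⟩ := List.length_eq_one_iff.1 hk
        exact absurd (.der l p) (hn _)
      · exact absurd (.derZero l ps hk) (hn _)
    · have key : ∀ B, ∃ Γ, HasTy (der m) Γ B := fun B => h₁ (Ty.bag [B])
      exact ⟨(key (Ty.bag [])).imp fun Γ h => ⟨_, h⟩, Or.inr key⟩
  | es m n, b, hn, hs => by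
    obtain ⟨hm, hn'⟩ := hs
    obtain ⟨-, ⟨l, ps, rfl⟩ | h₂⟩ := Normal.typable n (fun r hr => hn _ (.esR m hr)) hn'
    · by_cases hk : deg 0 m = ps.length
      · exact absurd (.sub l m ps ps hk (.refl _)) (hn _)
      · exact absurd (.subZero l m ps hk) (hn _)
    · have key : ∀ Γ B, HasTy m Γ B → ∃ Γ', HasTy (es m n) Γ' B := fun Γ B h => by
        obtain ⟨As, hA⟩ := Quot.exists_rep (TyCtx.proj 0 Γ)
        obtain ⟨Δ, hΔ⟩ := h₂ (Ty.bag As)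
        exact ⟨_, Γ, Δ, As, hA.symm, rfl, h, hΔ⟩
      obtain ⟨⟨Γ, A, h⟩, h'⟩ := Normal.typable m (fun r hr => hn _ (.esL n hr)) hm
      refine ⟨(key Γ A h).imp fun Γ h => ⟨_, h⟩, h'.imp (fun h => h.es n) fun h' B => ?_⟩
      obtain ⟨Γ, h⟩ := h' B
      exact key Γ B h
  | bag ms, b, hn, hs => by
    obtain ⟨rfl, hs⟩ := hs
    obtain ⟨Γ, As, h⟩ := Normal.exists_hasTys ms
      (fun as m bs he r hr => by subst he; exact hn _ (.bagCtx as bs hr)) hs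
    exact ⟨⟨Γ, _, As, As, rfl, .refl _, h⟩, Or.inl ⟨[], ms, rfl⟩⟩
theorem Normal.exists_hasTys : ∀ ms : List ResPre,
    (∀ as m bs, ms = as ++ m :: bs → Normal m) → AllElem ms → ∃ Γ As, HasTys ms Γ As
  | [], hn, hs => ⟨0, [], rfl, rfl⟩
  | m :: ms, hn, hs => by
    obtain ⟨⟨Γ, A, h₁⟩, -⟩ := Normal.typable m (hn [] m ms rfl) hs.1
    obtain ⟨Δ, As, h₂⟩ := Normal.exists_hasTys ms
      (fun as p bs he => hn (m :: as) p bs (by rw [he]; rfl)) hs.2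
    exact ⟨_, _, Γ, Δ, A, As, rfl, rfl, h₁, h₂⟩
end

/-- The sort travels forwards along the reduction, and the typing of the normal form travels
backwards. -/
theorem hasTy_of_isNormalFormOf {m : ResPre} {b : Bool} (hs : IsSort b m) {u : ResTerm}
    (h : ResTerm.IsNormalFormOf u (ResTerm.mk m)) : ∃ Γ A, HasTy m Γ A := by
  obtain ⟨p, rfl, hp⟩ := exists_isSort_of_reflTransGen h.1 rfl hs
  obtain ⟨⟨Γ, A, hA⟩, -⟩ := Normal.typable p (fun r hr => h.2 _ ⟨p, r, rfl, rfl, hr⟩) hp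
  exact ⟨Γ, A, hasTy_of_reflTransGen h.1 rfl hA rfl⟩

end ResPre

-- Typing of call-by-value terms and subject expansion

namespace TyCtx

/-- `Sum P Γ As`: the context `Γ` is a sum of contexts in which the judgement `P` holds with the
respective types in `As`. -/
def Sum (P : TyCtx → Ty → Prop) : TyCtx → List Ty → Prop
  | Γ, [] => Γ = 0
  | Γ, A :: As => ∃ Γ₁ Γ₂, Γ = Γ₁ + Γ₂ ∧ P Γ₁ A ∧ Sum P Γ₂ As

/-- `Abs P Γ A`: the type `A` of an abstraction in the context `Γ`, where `P` is the typing
judgement of its body. -/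
def Abs (P : TyCtx → Ty → Prop) (Γ : TyCtx) (A : Ty) : Prop :=
  ∃ Θ Bs B, A = Ty.arr (Ty.bag Bs) B ∧ proj 0 Θ = Bs ∧ Γ = unbind 0 Θ ∧ P Θ B

theorem Sum.append {P : TyCtx → Ty → Prop} {Δ : TyCtx} {Bs : List Ty} (hB : Sum P Δ Bs) :
    ∀ {As : List Ty} {Γ : TyCtx}, Sum P Γ As → Sum P (Γ + Δ) (As ++ Bs)
  | [], Γ, h => by
    cases h
    simpa using hB
  | A :: As, Γ, h => by
    obtain ⟨Γ₁, Γ₂, rfl, h₁, h₂⟩ := h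
    exact ⟨Γ₁, Γ₂ + Δ, by rw [add_assoc], h₁, hB.append h₂⟩

/-- Here `R` is any relation of contexts compatible with sums. It is used with renaming,
substitution and equality, and reduces the abstraction case to a single typing of the body. -/
theorem Sum.transfer {P Q : TyCtx → Ty → Prop} {R : TyCtx → TyCtx → Prop} (h₀ : R 0 0)
    (hadd : ∀ {Γ Γ' Δ Δ'}, R Γ Δ → R Γ' Δ' → R (Γ + Γ') (Δ + Δ'))
    (h : ∀ Γ A, P Γ A → ∃ Δ, R Γ Δ ∧ Q Δ A) :
    ∀ {As : List Ty} {Γ : TyCtx}, Sum P Γ As → ∃ Δ, R Γ Δ ∧ Sum Q Δ As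
  | [], Γ, hs => by
    cases hs
    exact ⟨0, h₀, rfl⟩
  | A :: As, Γ, hs => by
    obtain ⟨Γ₁, Γ₂, rfl, h₁, h₂⟩ := hs
    obtain ⟨Δ₁, hR₁, h₁⟩ := h _ _ h₁
    obtain ⟨Δ₂, hR₂, h₂⟩ := Sum.transfer h₀ hadd h h₂
    exact ⟨_, hadd hR₁ hR₂, Δ₁, Δ₂, rfl, h₁, h₂⟩

theorem Sum.mono {P Q : TyCtx → Ty → Prop} (h : ∀ Γ A, P Γ A → Q Γ A) {As : List Ty} {Γ : TyCtx}
    (hs : Sum P Γ As) : Sum Q Γ As := by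
  obtain ⟨_, rfl, h⟩ := Sum.transfer (R := Eq) rfl (fun h h' => h ▸ h' ▸ rfl)
    (fun Γ A hP => ⟨Γ, rfl, h Γ A hP⟩) hs
  exact h

end TyCtx

namespace VTerm

/-- `HasTy M Γ A`: the term `M` has the type `A` in the context `Γ`. -/
def HasTy : VTerm → TyCtx → Ty → Prop
  | var i, Γ, A => ∃ As, A = Ty.bag As ∧ Γ = TyCtx.single i As
  | lam M, Γ, T => ∃ As, T = Ty.bag As ∧ TyCtx.Sum (TyCtx.Abs (HasTy M)) Γ As
  | app M N, Γ, B => ∃ Γ₁ Γ₂ A, Γ = Γ₁ + Γ₂ ∧ HasTy M Γ₁ (Ty.bag [Ty.arr A B]) ∧ HasTy N Γ₂ A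
  | es M N, Γ, B => ∃ Θ Γ₂ As, TyCtx.proj 0 Θ = (As : List Ty) ∧ Γ = TyCtx.unbind 0 Θ + Γ₂ ∧
      HasTy M Θ B ∧ HasTy N Γ₂ (Ty.bag As)

theorem hasTy_lam_singleton {M : VTerm} {Γ : TyCtx} {A : Ty} :
    HasTy (lam M) Γ (Ty.bag [A]) ↔ TyCtx.Abs (HasTy M) Γ A := by
  constructor
  · rintro ⟨As, he, h⟩
    cases he
    obtain ⟨Γ₁, Γ₂, rfl, h, rfl⟩ := h
    simpa using h
  · intro h
    exact ⟨_, rfl, Γ, 0, by simp, h, rfl⟩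

theorem IsValue.eq_bag {V : VTerm} (hV : IsValue V) {Γ : TyCtx} {A : Ty} (h : HasTy V Γ A) :
    ∃ As, A = Ty.bag As := by
  cases hV <;> obtain ⟨As, hA, -⟩ := h <;> exact ⟨As, hA⟩

/-- This starts subject expansion, and it types a value that is substituted for a variable without
declarations. -/
theorem IsValue.hasTy_nil {V : VTerm} (hV : IsValue V) : HasTy V 0 (Ty.bag []) := by
  cases hV <;> exact ⟨[], rfl, rfl⟩

/-- This merges the typings of the several copies of a substituted value into one. -/
theorem IsValue.hasTy_append {V : VTerm} (hV : IsValue V) {Γ Δ : TyCtx} {As Bs : List Ty}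
    (hA : HasTy V Γ (Ty.bag As)) (hB : HasTy V Δ (Ty.bag Bs)) :
    HasTy V (Γ + Δ) (Ty.bag (As ++ Bs)) := by
  cases hV with
  | var i =>
    obtain ⟨_, ⟨⟩, rfl⟩ := hA
    obtain ⟨_, ⟨⟩, rfl⟩ := hB
    exact ⟨_, rfl, (TyCtx.single_append _ _ _).symm⟩
  | lam M =>
    obtain ⟨_, ⟨⟩, hA⟩ := hA
    obtain ⟨_, ⟨⟩, hB⟩ := hB
    exact ⟨_, rfl, hB.append hA⟩

theorem HasTy.of_rename {M : VTerm} : ∀ {ρ : ℕ → ℕ} {Δ : TyCtx} {A : Ty},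
    HasTy (rename ρ M) Δ A → ∃ Γ, Δ = TyCtx.ren ρ Γ ∧ HasTy M Γ A := by
  induction M with
  | var i =>
    rintro ρ Δ A ⟨As, rfl, rfl⟩
    exact ⟨_, (TyCtx.ren_single ρ i As).symm, As, rfl, rfl⟩
  | lam M ih =>
    rintro ρ Δ A ⟨As, rfl, h⟩
    obtain ⟨Γ, rfl, hs⟩ := TyCtx.Sum.transfer (R := fun Δ Γ => Δ = TyCtx.ren ρ Γ)
      (Q := TyCtx.Abs (HasTy M)) (by simp)
      (fun h h' => by simp [h, h']) (fun Γ A hA => by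
        obtain ⟨Θ, Bs, B, rfl, hp, rfl, h⟩ := hA
        obtain ⟨Θ, rfl, h'⟩ := ih h
        exact ⟨TyCtx.unbind 0 Θ, by simp, Θ, Bs, B, rfl, by simpa using hp, rfl, h'⟩) h
    exact ⟨Γ, rfl, As, rfl, hs⟩
  | app M N ih₁ ih₂ =>
    rintro ρ Δ B ⟨Γ₁, Γ₂, A, rfl, h₁, h₂⟩
    obtain ⟨Γ₁, rfl, h₁'⟩ := ih₁ h₁
    obtain ⟨Γ₂, rfl, h₂'⟩ := ih₂ h₂
    exact ⟨Γ₁ + Γ₂, by simp, Γ₁, Γ₂, A, rfl, h₁', h₂'⟩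
  | es M N ih₁ ih₂ =>
    rintro ρ Δ B ⟨Θ, Γ₂, As, hp, rfl, h₁, h₂⟩
    obtain ⟨Θ, rfl, h₁'⟩ := ih₁ h₁
    obtain ⟨Γ₂, rfl, h₂'⟩ := ih₂ h₂
    exact ⟨TyCtx.unbind 0 Θ + Γ₂, by simp, Θ, Γ₂, As, by simpa using hp, rfl, h₁', h₂'⟩

/-- `SubstTy σ Γ Δ`: the terms `σ x` have, in contexts with the sum `Γ`, the types that `Δ`
declares for `x`. -/
inductive SubstTy (σ : ℕ → VTerm) : TyCtx → TyCtx → Prop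
  | zero : SubstTy σ 0 0
  | add {Γ Δ G : TyCtx} {As : List Ty} (x : ℕ) : SubstTy σ Γ Δ → HasTy (σ x) G (Ty.bag As) →
      SubstTy σ (Γ + G) (Δ + TyCtx.single x As)

theorem SubstTy.sum {σ : ℕ → VTerm} {Γ Γ' Δ Δ' : TyCtx} (h : SubstTy σ Γ Δ)
    (h' : SubstTy σ Γ' Δ') : SubstTy σ (Γ + Γ') (Δ + Δ') := by
  induction h' with
  | zero => simpa using h
  | add x _ hx ih =>
    rw [← add_assoc, ← add_assoc]
    exact ih.add x hx

/-- A lifted substitution maps `0` to itself, so those declarations agree on both sides. The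
remaining terms are shifted and do not mention `0`. -/
theorem SubstTy.unlift {σ : ℕ → VTerm} {Γ Δ : TyCtx} (h : SubstTy (liftSubst σ) Γ Δ) :
    TyCtx.proj 0 Δ = TyCtx.proj 0 Γ ∧ SubstTy σ (TyCtx.unbind 0 Γ) (TyCtx.unbind 0 Δ) := by
  induction h with
  | zero => exact ⟨rfl, .zero⟩
  | add x _ hx ih =>
    obtain ⟨ih₁, ih₂⟩ := ih
    cases x with
    | zero =>
      obtain ⟨_, ⟨⟩, rfl⟩ := hx
      simpa [TyCtx.unbind_single_self, ih₁] using ih₂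
    | succ x =>
      obtain ⟨G, rfl, hG⟩ := HasTy.of_rename hx
      have := ih₂.add x hG
      simpa [TyCtx.unbind_single_of_ne, TyCtx.proj_single_of_ne, ih₁] using this

theorem IsValue.rename {V : VTerm} (h : IsValue V) (ρ : ℕ → ℕ) : IsValue (rename ρ V) := by
  cases h <;> constructor

theorem isValue_liftSubst {σ : ℕ → VTerm} (h : ∀ i, IsValue (σ i)) (i : ℕ) :
    IsValue (liftSubst σ i) := by
  cases i
  exacts [.var 0, (h _).rename _]

/-- Values are needed because a variable has only bag types, so the type found at `σ i` has to be a
bag. -/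
theorem HasTy.of_subst {M : VTerm} : ∀ {σ : ℕ → VTerm} {Γ : TyCtx} {A : Ty},
    (∀ i, IsValue (σ i)) → HasTy (subst σ M) Γ A → ∃ Δ, SubstTy σ Γ Δ ∧ HasTy M Δ A := by
  induction M with
  | var i =>
    intro σ Γ A hσ h
    obtain ⟨As, rfl⟩ := (hσ i).eq_bag h
    exact ⟨TyCtx.single i As, by simpa using SubstTy.zero.add i h, As, rfl, rfl⟩
  | lam M ih =>
    rintro σ Γ A hσ ⟨As, rfl, h⟩
    obtain ⟨Δ, hs, h⟩ := TyCtx.Sum.transfer (R := SubstTy σ) (Q := TyCtx.Abs (HasTy M)) .zero SubstTy.sum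
      (fun Γ A hA => by
        obtain ⟨Θ, Bs, B, rfl, hp, rfl, h⟩ := hA
        obtain ⟨Δ, hs, h'⟩ := ih (isValue_liftSubst hσ) h
        exact ⟨_, hs.unlift.2, Δ, Bs, B, rfl, hs.unlift.1.trans hp, rfl, h'⟩) h
    exact ⟨Δ, hs, As, rfl, h⟩
  | app M N ih₁ ih₂ =>
    rintro σ Γ B hσ ⟨Γ₁, Γ₂, A, rfl, h₁, h₂⟩
    obtain ⟨Δ₁, hs₁, h₁⟩ := ih₁ hσ h₁
    obtain ⟨Δ₂, hs₂, h₂⟩ := ih₂ hσ h₂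
    exact ⟨_, hs₁.sum hs₂, Δ₁, Δ₂, A, rfl, h₁, h₂⟩
  | es M N ih₁ ih₂ =>
    rintro σ Γ B hσ ⟨Θ, Γ₂, As, hp, rfl, h₁, h₂⟩
    obtain ⟨Δ₁, hs₁, h₁⟩ := ih₁ (isValue_liftSubst hσ) h₁
    obtain ⟨Δ₂, hs₂, h₂⟩ := ih₂ hσ h₂
    exact ⟨_, hs₁.unlift.2.sum hs₂, Δ₁, Δ₂, As, hs₁.unlift.1.trans hp, rfl, h₁, h₂⟩

/-- Anti-substitution: the typings of all copies of `V` are collected into a single bag type, empty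
if there are none. -/
theorem HasTy.of_inst {M V : VTerm} (hV : IsValue V) {Γ : TyCtx} {A : Ty}
    (h : HasTy (inst M V) Γ A) : ∃ Θ Δ As, TyCtx.proj 0 Θ = (As : List Ty) ∧
      Γ = TyCtx.unbind 0 Θ + Δ ∧ HasTy M Θ A ∧ HasTy V Δ (Ty.bag As) := by
  obtain ⟨Θ, hs, hM⟩ := HasTy.of_subst (by rintro (_ | i); exacts [hV, .var i]) h
  clear h
  suffices ∃ Δ As, TyCtx.proj 0 Θ = (As : List Ty) ∧ Γ = TyCtx.unbind 0 Θ + Δ ∧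
      HasTy V Δ (Ty.bag As) by
    obtain ⟨Δ, As, hp, hΓ, h⟩ := this
    exact ⟨Θ, Δ, As, hp, hΓ, hM, h⟩
  clear hM
  induction hs with
  | zero => exact ⟨0, [], rfl, rfl, hV.hasTy_nil⟩
  | @add _ _ G Bs x _ hx ih =>
    obtain ⟨Δ, As, hp, rfl, h⟩ := ih
    cases x with
    | zero =>
      refine ⟨Δ + G, As ++ Bs, ?_, ?_, hV.hasTy_append h hx⟩
      · simp [hp, TyCtx.proj_single_self]
      · simp [TyCtx.unbind_single_self, add_assoc]
    | succ x =>
      -- The other indices are replaced by variables, so their declarations reappear one index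
      -- lower.
      obtain ⟨_, ⟨⟩, rfl⟩ := hx
      refine ⟨Δ, As, ?_, ?_, h⟩
      · simp [hp, TyCtx.proj_single_of_ne]
      · simp only [TyCtx.unbind_add, TyCtx.unbind_single_of_ne (Nat.succ_ne_zero x)]
        simp only [Nat.not_lt_zero, if_false]
        abel

theorem hasTy_plugL (L : List VTerm) : ∀ {M : VTerm} {Γ : TyCtx} {A : Ty},
    HasTy (plugL L M) Γ A ↔ ∃ Θ, TyCtx.ListTy (L.map HasTy) Θ Γ ∧ HasTy M Θ A := by
  induction L with
  | nil =>
    intro m Γ A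
    exact ⟨fun h => ⟨Γ, rfl, h⟩, by rintro ⟨_, rfl, h⟩; exact h⟩
  | cons n l ih =>
    intro m Γ A
    rw [plugL, ih]
    constructor
    · rintro ⟨_, hl, Θ, Δ, As, hp, rfl, h₁, h₂⟩
      exact ⟨Θ, ⟨Δ, As, hp, h₂, hl⟩, h₁⟩
    · rintro ⟨Θ, ⟨Δ, As, hp, h₂, hl⟩, h₁⟩
      exact ⟨_, hl, Θ, Δ, As, hp, rfl, h₁, h₂⟩

theorem Step.hasTy_of_hasTy {M M' : VTerm} (h : Step M M') :
    ∀ {Γ : TyCtx} {A : Ty}, HasTy M' Γ A → HasTy M Γ A := by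
  induction h with
  | beta L M N =>
    intro Γ B h
    obtain ⟨_, hL, Θ, Δ, As, hp, rfl, h₁, h₂⟩ := (hasTy_plugL L).1 h
    obtain ⟨Δ, rfl, h₂'⟩ := HasTy.of_rename h₂
    obtain ⟨Γ₁, rfl, hL'⟩ := (TyCtx.listTy_add (List.length_map _)).1 hL
    exact ⟨Γ₁, Δ, _, rfl, (hasTy_plugL L).2 ⟨_, hL', hasTy_lam_singleton.2
      ⟨Θ, As, B, rfl, hp, rfl, h₁⟩⟩, h₂'⟩
  | sub L M V hV =>
    intro Γ B h
    obtain ⟨_, hL, h⟩ := (hasTy_plugL L).1 h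
    obtain ⟨Θ, Δ, As, hp, rfl, h₁, h₂⟩ := HasTy.of_inst hV h
    obtain ⟨Θ, rfl, h₁'⟩ := HasTy.of_rename h₁
    rw [TyCtx.unbind_zero_ren_liftRen, add_comm, TyCtx.listTy_add (List.length_map _)] at hL
    obtain ⟨Γ, rfl, hL'⟩ := hL
    exact ⟨Θ, Γ, As, by simpa using hp, add_comm _ _, h₁', (hasTy_plugL L).2 ⟨_, hL', h₂⟩⟩
  | lam _ ih =>
    rintro Γ A ⟨As, hA, h⟩
    exact ⟨As, hA, h.mono fun Γ A ⟨Θ, Bs, B, hA, hp, he, h⟩ => ⟨Θ, Bs, B, hA, hp, he, ih h⟩⟩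
  | appL N _ ih =>
    rintro Γ B ⟨Γ₁, Γ₂, A, he, h₁, h₂⟩
    exact ⟨Γ₁, Γ₂, A, he, ih h₁, h₂⟩
  | appR M _ ih =>
    rintro Γ B ⟨Γ₁, Γ₂, A, he, h₁, h₂⟩
    exact ⟨Γ₁, Γ₂, A, he, h₁, ih h₂⟩
  | esL N _ ih =>
    rintro Γ B ⟨Θ, Δ, As, hp, he, h₁, h₂⟩
    exact ⟨Θ, Δ, As, hp, he, ih h₁, h₂⟩
  | esR M _ ih =>
    rintro Γ B ⟨Θ, Δ, As, hp, he, h₁, h₂⟩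
    exact ⟨Θ, Δ, As, hp, he, h₁, ih h₂⟩

-- From meaningfulness to the Taylor normal form

/-- A function in an application has a bag type with exactly one arrow, so the body of an
abstraction in that position is typed exactly once and the hole is never skipped. -/
theorem TestCtx.exists_hasTy {M : VTerm} (T : TestCtx) : ∀ {Γ : TyCtx} {A : Ty},
    HasTy (T.plug M) Γ A → ∃ Δ B, HasTy M Δ B := by
  induction T with
  | hole => intro Γ A h; exact ⟨Γ, A, h⟩
  | app T N ih =>
    rintro Γ B ⟨Γ₁, Γ₂, A, -, h, -⟩
    exact ih h
  | absApp x T N ih =>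
    rintro Γ B ⟨Γ₁, Γ₂, A, -, h, -⟩
    obtain ⟨Θ, Bs, C, -, -, -, h⟩ := hasTy_lam_singleton.1 h
    obtain ⟨Δ, -, h⟩ := HasTy.of_rename h
    exact ih h

theorem Meaningful.exists_hasTy {M : VTerm} (h : Meaningful M) : ∃ Γ A, HasTy M Γ A := by
  obtain ⟨T, V, hV, h⟩ := h
  have key : ∀ {N}, Relation.ReflTransGen Step N V → HasTy N 0 (Ty.bag []) := by
    intro N h
    induction h using Relation.ReflTransGen.head_induction_on with
    | refl => exact hV.hasTy_nil
    | head hs _ ih => exact hs.hasTy_of_hasTy ih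
  exact T.exists_hasTy (key h)

/-- The derivation dictates the approximant: a value of type `Ty.bag As` is approximated by a bag
with one element for each type in `As`. -/
theorem HasTy.exists_approxV {M : VTerm} : ∀ {Γ : TyCtx} {A : Ty}, HasTy M Γ A →
    ∃ m, ResPre.ApproxV m M ∧ ResPre.HasTy m Γ A := by
  induction M with
  | var i =>
    rintro Γ A ⟨As, rfl, rfl⟩
    refine ⟨_, .var As.length i, As, As, rfl, .refl _, ?_⟩
    induction As with
    | nil => exact ⟨rfl, rfl⟩
    | cons A As ih => exact ⟨_, _, A, As, TyCtx.single_cons i A As, rfl, rfl, ih⟩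
  | lam M ih =>
    rintro Γ A ⟨As, rfl, h⟩
    suffices ∃ ms : List ResPre, (∀ m ∈ ms, ResPre.ApproxV m M) ∧
        ResPre.HasTys (ms.map ResPre.lam) Γ As by
      obtain ⟨ms, hm, h⟩ := this
      exact ⟨_, .lam ms M hm, As, As, rfl, .refl _, h⟩
    induction As generalizing Γ with
    | nil => exact ⟨[], by simp, h, rfl⟩
    | cons A As ihA =>
      obtain ⟨Γ₁, Γ₂, rfl, ⟨Θ, Bs, B, rfl, hp, rfl, h₁⟩, h₂⟩ := h
      obtain ⟨m, hm, h₁⟩ := ih h₁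
      obtain ⟨ms, hms, h₂⟩ := ihA h₂
      exact ⟨m :: ms, by simpa using ⟨hm, hms⟩, _, _, _, _, rfl, rfl,
        ⟨Θ, Bs, B, rfl, hp, rfl, h₁⟩, h₂⟩
  | app M N ih₁ ih₂ =>
    rintro Γ B ⟨Γ₁, Γ₂, A, rfl, h₁, h₂⟩
    obtain ⟨m, hm, h₁⟩ := ih₁ h₁
    obtain ⟨n, hn, h₂⟩ := ih₂ h₂
    -- A value in function position is approximated by a bag. Its type has a single element, so the
    -- bag does too, and the application rule for values applies.
    by_cases hM : IsValue M
    · have hbag : ∃ ms, m = ResPre.bag ms := by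
        cases hM <;> cases hm <;> exact ⟨_, rfl⟩
      obtain ⟨ms, rfl⟩ := hbag
      obtain ⟨As, Bs, he, hp, h₁⟩ := h₁
      cases he
      cases List.perm_singleton.1 hp
      obtain ⟨p, rfl⟩ := List.length_eq_one_iff.1 (h₁.length.symm : ms.length = 1)
      obtain ⟨Γ₁, _, _, _, rfl, he, h₁, rfl, rfl⟩ := h₁
      cases he
      exact ⟨_, .appVal hM hm hn, Γ₁, Γ₂, A, by simp, h₁, h₂⟩
    · exact ⟨_, .appDer hM hm hn, Γ₁, Γ₂, A, rfl, h₁, h₂⟩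
  | es M N ih₁ ih₂ =>
    rintro Γ B ⟨Θ, Γ₂, As, hp, rfl, h₁, h₂⟩
    obtain ⟨m, hm, h₁⟩ := ih₁ h₁
    obtain ⟨n, hn, h₂⟩ := ih₂ h₂
    exact ⟨_, .es hm hn, Θ, Γ₂, As, hp, rfl, h₁, h₂⟩

theorem Meaningful.taylorNF_nonempty {M : VTerm} (h : Meaningful M) : M.taylorNF.Nonempty := by
  obtain ⟨Γ, A, hA⟩ := h.exists_hasTy
  obtain ⟨m, hm, hA⟩ := hA.exists_approxV
  obtain ⟨u, hu⟩ := hA.exists_isNormalFormOf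
  exact ⟨u, _, ⟨m, rfl, hm⟩, hu⟩

end VTerm

namespace VTerm

/-! ### Renaming and substitution -/

theorem subst_congr {σ τ : ℕ → VTerm} (h : ∀ i, σ i = τ i) (M : VTerm) :
    subst σ M = subst τ M := by
  rw [funext h]

theorem liftRen_id : liftRen (fun j => j) = fun j => j := by
  funext i
  cases i <;> rfl

theorem rename_id (M : VTerm) : rename (fun j => j) M = M := by
  induction M <;> simp_all [rename, liftRen_id]

theorem liftSubst_var : liftSubst var = var := by
  funext i
  cases i <;> rfl

theorem subst_var (M : VTerm) : subst var M = M := by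
  induction M <;> simp_all [subst, liftSubst_var]

theorem rename_rename (M : VTerm) : ∀ ρ θ : ℕ → ℕ,
    rename ρ (rename θ M) = rename (fun i => ρ (θ i)) M := by
  have key : ∀ ρ θ : ℕ → ℕ,
      (fun i => liftRen ρ (liftRen θ i)) = liftRen fun i => ρ (θ i) := by
    intro ρ θ
    funext i
    cases i <;> rfl
  induction M <;> simp_all [rename]

theorem subst_rename (M : VTerm) : ∀ (σ : ℕ → VTerm) (θ : ℕ → ℕ),
    subst σ (rename θ M) = subst (fun i => σ (θ i)) M := by
  have key : ∀ (σ : ℕ → VTerm) (θ : ℕ → ℕ),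
      (fun i => liftSubst σ (liftRen θ i)) = liftSubst fun i => σ (θ i) := by
    intro σ θ
    funext i
    cases i <;> rfl
  induction M <;> simp_all [rename, subst]

theorem rename_subst (M : VTerm) : ∀ (ρ : ℕ → ℕ) (σ : ℕ → VTerm),
    rename ρ (subst σ M) = subst (fun i => rename ρ (σ i)) M := by
  have key : ∀ (ρ : ℕ → ℕ) (σ : ℕ → VTerm),
      (fun i => rename (liftRen ρ) (liftSubst σ i)) = liftSubst fun i => rename ρ (σ i) := by
    intro ρ σ
    funext i
    cases i
    · rfl
    · simp only [liftSubst, rename_rename]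
      rfl
  induction M <;> simp_all [rename, subst]

theorem subst_subst (M : VTerm) : ∀ σ τ : ℕ → VTerm,
    subst τ (subst σ M) = subst (fun i => subst τ (σ i)) M := by
  have key : ∀ σ τ : ℕ → VTerm,
      (fun i => subst (liftSubst τ) (liftSubst σ i)) = liftSubst fun i => subst τ (σ i) := by
    intro σ τ
    funext i
    cases i
    · rfl
    · simp only [liftSubst, subst_rename, rename_subst]
  induction M <;> simp_all [subst]

/-- The substitution of `N` for the index `0` and of `σ` for the others. -/
def scons (N : VTerm) (σ : ℕ → VTerm) : ℕ → VTerm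
  | 0 => N
  | j + 1 => σ j

theorem inst_eq_subst (M N : VTerm) : inst M N = subst (scons N var) M :=
  subst_congr (fun i => by cases i <;> rfl) M

theorem inst_subst_liftSubst (M N : VTerm) (σ : ℕ → VTerm) :
    inst (subst (liftSubst σ) M) N = subst (scons N σ) M := by
  rw [inst_eq_subst, subst_subst]
  refine subst_congr (fun i => ?_) M
  cases i
  · rfl
  · exact (subst_rename _ _ _).trans (subst_var _)

/-- Reduction in any number of steps. -/
abbrev Steps : VTerm → VTerm → Prop := Relation.ReflTransGen Step

theorem Steps.app {M M' N N' : VTerm} (hM : Steps M M') (hN : Steps N N') :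
    Steps (app M N) (app M' N') :=
  (hM.lift (fun M => VTerm.app M N) fun _ _ => .appL N).trans
    (hN.lift (VTerm.app M') fun _ _ => .appR M')

theorem Steps.esR (M : VTerm) {N N' : VTerm} (hN : Steps N N') : Steps (es M N) (es M N') :=
  hN.lift (es M) fun _ _ => .esR M

theorem step_app_lam (M N : VTerm) : Step (app (lam M) N) (es M N) := by
  simpa [plugL, rename_id] using Step.beta [] M N

theorem step_es_value (M : VTerm) {V : VTerm} (hV : IsValue V) : Step (es M V) (inst M V) := by
  simpa [plugL, rename_id, liftRen_id] using Step.sub [] M V hV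

theorem steps_app_lam (M : VTerm) {V : VTerm} (hV : IsValue V) :
    Steps (app (lam M) V) (inst M V) :=
  .head (step_app_lam M V) (.single (step_es_value M hV))

/-! ### Realizability -/

mutual
/-- `Realizes A V`: the value `V` realizes the type `A`. -/
def Realizes : Ty → VTerm → Prop
  | Ty.arr A B, V => ∀ W, IsValue W → Realizes A W →
      ∃ V', IsValue V' ∧ Realizes B V' ∧ Steps (app V W) V'
  | Ty.bag As, V => RealizesAll As V
/-- `V` realizes all types in a list. -/
def RealizesAll : List Ty → VTerm → Prop
  | [], _ => True
  | A :: As, V => Realizes A V ∧ RealizesAll As V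
end

theorem realizesAll_iff {As : List Ty} {V : VTerm} :
    RealizesAll As V ↔ ∀ A ∈ As, Realizes A V := by
  induction As with
  | nil => simp [RealizesAll]
  | cons A As ih => simp [RealizesAll, ih]

/-- `V` realizes the types that `Γ` declares for the variable that it is substituted for. -/
def RealizesCtx (Γ : TyCtx) (σ : ℕ → VTerm) : Prop :=
  (∀ i, IsValue (σ i)) ∧ ∀ i A, (i, A) ∈ Γ → Realizes A (σ i)

theorem realizesCtx_add {Γ Δ : TyCtx} {σ : ℕ → VTerm} :
    RealizesCtx (Γ + Δ) σ ↔ RealizesCtx Γ σ ∧ RealizesCtx Δ σ := by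
  simp only [RealizesCtx, Multiset.mem_add, or_imp, forall_and]
  tauto

theorem RealizesCtx.scons {Θ : TyCtx} {As : List Ty} {V : VTerm} {σ : ℕ → VTerm}
    (hp : TyCtx.proj 0 Θ = As) (h : RealizesCtx (TyCtx.unbind 0 Θ) σ) (hV : IsValue V)
    (hA : Realizes (Ty.bag As) V) : RealizesCtx Θ (scons V σ) := by
  refine ⟨fun i => ?_, fun i A hi => ?_⟩
  · cases i
    exacts [hV, h.1 _]
  · cases i with
    | zero =>
      have := TyCtx.mem_proj hi
      rw [hp] at this
      exact realizesAll_iff.1 hA A this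
    | succ i => exact h.2 i A (TyCtx.mem_unbind_zero hi)

/-- The elements of one bag approximate the same value, so a single `V` has to realize all their
types. -/
theorem realizesAll_of_hasTys {ms : List ResPre} {σ : ℕ → VTerm} {V : VTerm}
    (h : ∀ m ∈ ms, ∀ {Γ : TyCtx} {A : Ty}, ResPre.HasTy m Γ A → RealizesCtx Γ σ →
      Realizes A V) : ∀ {Γ : TyCtx} {As : List Ty}, ResPre.HasTys ms Γ As → RealizesCtx Γ σ →
      RealizesAll As V := by
  induction ms with
  | nil =>
    rintro Γ As ⟨-, rfl⟩ -
    trivial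
  | cons m ms ih =>
    rintro Γ As ⟨Γ₁, Γ₂, A, As', rfl, rfl, h₁, h₂⟩ hσ
    obtain ⟨hσ₁, hσ₂⟩ := realizesCtx_add.1 hσ
    exact ⟨h m (by simp) h₁ hσ₁, ih (fun m hm => h m (by simp [hm])) h₂ hσ₂⟩

theorem realizes_bag_of_hasTy {ms : List ResPre} {σ : ℕ → VTerm} {V : VTerm}
    (h : ∀ m ∈ ms, ∀ {Γ : TyCtx} {A : Ty}, ResPre.HasTy m Γ A → RealizesCtx Γ σ →
      Realizes A V) {Γ : TyCtx} {A : Ty} (hA : ResPre.HasTy (ResPre.bag ms) Γ A)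
    (hσ : RealizesCtx Γ σ) : Realizes A V := by
  obtain ⟨As, Bs, rfl, hp, hA⟩ := hA
  exact realizesAll_iff.2 fun A hm =>
    realizesAll_iff.1 (realizesAll_of_hasTys h hA hσ) A (hp.symm.subset hm)

/-- Adequacy, by induction on the approximation. The typing of `m` only has to provide realizers,
while `M` does the reducing; a bag with many elements still corresponds to one value of `M`. -/
theorem exists_steps_realizes {m : ResPre} {M : VTerm} (h : ResPre.ApproxV m M) :
    ∀ {Γ : TyCtx} {A : Ty} {σ : ℕ → VTerm}, ResPre.HasTy m Γ A → RealizesCtx Γ σ →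
      ∃ V, IsValue V ∧ Realizes A V ∧ Steps (subst σ M) V := by
  induction h with
  | var k i =>
    intro Γ A σ hA hσ
    refine ⟨σ i, hσ.1 i, realizes_bag_of_hasTy (fun m hm Γ A hA hσ => ?_) hA hσ, .refl⟩
    cases List.eq_of_mem_replicate hm
    cases hA
    exact hσ.2 i A (by simp [TyCtx.single])
  | lam ms M _ ih =>
    intro Γ A σ hA hσ
    refine ⟨_, .lam _, realizes_bag_of_hasTy (fun m hm Γ A hA hσ => ?_) hA hσ, .refl⟩
    obtain ⟨m, hm', rfl⟩ := List.mem_map.1 hm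
    obtain ⟨Θ, As, B, rfl, hp, rfl, hB⟩ := hA
    intro W hW hWA
    obtain ⟨V, hV, hVB, hs⟩ := ih m hm' hB (hσ.scons hp hW hWA)
    rw [← inst_subst_liftSubst] at hs
    exact ⟨V, hV, hVB, (steps_app_lam _ hW).trans hs⟩
  | appDer _ _ _ ih₁ ih₂ =>
    rintro Γ B σ ⟨Γ₁, Γ₂, A, rfl, h₁, h₂⟩ hσ
    obtain ⟨hσ₁, hσ₂⟩ := realizesCtx_add.1 hσ
    obtain ⟨V, hV, hVA, hs₁⟩ := ih₁ (A := Ty.bag [Ty.arr A B]) h₁ hσ₁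
    obtain ⟨W, hW, hWA, hs₂⟩ := ih₂ h₂ hσ₂
    obtain ⟨V', hV', hVB, hs⟩ := hVA.1 W hW hWA
    exact ⟨V', hV', hVB, (hs₁.app hs₂).trans hs⟩
  | appVal _ _ _ ih₁ ih₂ =>
    rintro Γ B σ ⟨Γ₁, Γ₂, A, rfl, h₁, h₂⟩ hσ
    obtain ⟨hσ₁, hσ₂⟩ := realizesCtx_add.1 hσ
    obtain ⟨V, hV, hVA, hs₁⟩ := ih₁ (ResPre.hasTy_bag_singleton.2 h₁) hσ₁
    obtain ⟨W, hW, hWA, hs₂⟩ := ih₂ h₂ hσ₂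
    obtain ⟨V', hV', hVB, hs⟩ := hVA.1 W hW hWA
    exact ⟨V', hV', hVB, (hs₁.app hs₂).trans hs⟩
  | es _ _ ih₁ ih₂ =>
    rintro Γ B σ ⟨Θ, Δ, As, hp, rfl, h₁, h₂⟩ hσ
    obtain ⟨hσ₁, hσ₂⟩ := realizesCtx_add.1 hσ
    obtain ⟨W, hW, hWA, hs₂⟩ := ih₂ h₂ hσ₂
    obtain ⟨V, hV, hVB, hs₁⟩ := ih₁ h₁ (hσ₁.scons hp hW hWA)
    rw [← inst_subst_liftSubst] at hs₁
    exact ⟨V, hV, hVB, ((Steps.esR _ hs₂).tail (step_es_value _ hW)).trans hs₁⟩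

/-! ### Testing contexts -/

/-- The closed term `λx₀ … λxₖ xₖ`. -/
def eraser : ℕ → VTerm
  | 0 => lam (var 0)
  | k + 1 => lam (eraser k)

theorem isValue_eraser (k : ℕ) : IsValue (eraser k) := by
  cases k <;> exact .lam _

theorem subst_eraser (k : ℕ) : ∀ σ : ℕ → VTerm, subst σ (eraser k) = eraser k := by
  induction k with
  | zero => intro σ; rfl
  | succ k ih => intro σ; simp only [eraser, subst, ih]

-- An arrow costs one leading abstraction, whatever its argument. Asking for all large `k`, and not
-- just one, lets finitely many types share one eraser.
mutual
theorem exists_realizes_eraser : ∀ A : Ty, ∃ n, ∀ k ≥ n, Realizes A (eraser k)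
  | Ty.arr A B => by
    obtain ⟨n, hn⟩ := exists_realizes_eraser B
    refine ⟨n + 1, fun k hk W hW _ => ?_⟩
    obtain ⟨k, rfl⟩ : ∃ j, k = j + 1 := ⟨k - 1, by omega⟩
    have hs := steps_app_lam (eraser k) hW
    rw [inst_eq_subst, subst_eraser] at hs
    exact ⟨eraser k, isValue_eraser k, hn k (by omega), hs⟩
  | Ty.bag As => exists_realizesAll_eraser As
theorem exists_realizesAll_eraser : ∀ As : List Ty, ∃ n, ∀ k ≥ n, RealizesAll As (eraser k)
  | [] => ⟨0, fun _ _ => trivial⟩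
  | A :: As => by
    obtain ⟨n₁, h₁⟩ := exists_realizes_eraser A
    obtain ⟨n₂, h₂⟩ := exists_realizesAll_eraser As
    exact ⟨max n₁ n₂, fun k hk => ⟨h₁ k (le_trans (le_max_left _ _) hk),
      h₂ k (le_trans (le_max_right _ _) hk)⟩⟩
end

/-- A context is finite: `n` bounds its variables, and `k` serves all its types at once. -/
theorem exists_realizesCtx_eraser (Γ : TyCtx) :
    ∃ n k, RealizesCtx Γ fun i => if i < n then eraser k else var i := by
  suffices ∃ n k, ∀ i A, (i, A) ∈ Γ → i < n ∧ ∀ j ≥ k, Realizes A (eraser j) by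
    obtain ⟨n, k, h⟩ := this
    refine ⟨n, k, fun i => ?_, fun i A hi => ?_⟩
    · dsimp only
      split_ifs
      exacts [isValue_eraser k, .var i]
    · simp only [if_pos (h i A hi).1]
      exact (h i A hi).2 k le_rfl
  induction Γ using Multiset.induction with
  | empty => exact ⟨0, 0, by simp⟩
  | cons p Γ ih =>
    obtain ⟨n, k, h⟩ := ih
    obtain ⟨x, B⟩ := p
    obtain ⟨k', h'⟩ := exists_realizes_eraser B
    refine ⟨max n (x + 1), max k k', fun i A hi => ?_⟩
    rcases Multiset.mem_cons.1 hi with he | hi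
    · cases he
      exact ⟨by omega, fun j hj => h' j (by omega)⟩
    · exact ⟨by have := (h i A hi).1; omega, fun j hj => (h i A hi).2 j (by omega)⟩

/-- The composition of testing contexts. -/
def TestCtx.comp : TestCtx → TestCtx → TestCtx
  | .hole, S => S
  | .app T N, S => .app (T.comp S) N
  | .absApp x T N, S => .absApp x (T.comp S) N

theorem TestCtx.plug_comp (T S : TestCtx) (M : VTerm) :
    (T.comp S).plug M = T.plug (S.plug M) := by
  induction T <;> simp_all [TestCtx.comp, TestCtx.plug]

/-- Each `(λx □) N` with `N` an eraser captures and replaces one free variable. Erasers are closed,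
so the replacements do not interfere. -/
theorem exists_testCtx_steps (k n : ℕ) : ∃ T : TestCtx, ∀ M : VTerm,
    Steps (T.plug M) (subst (fun i => if i < n then eraser k else var i) M) := by
  induction n with
  | zero => exact ⟨.hole, fun M => by simp [subst_var, TestCtx.plug, Steps, Relation.ReflTransGen.refl]⟩
  | succ n ih =>
    obtain ⟨T, hT⟩ := ih
    -- The new binder is innermost: `T` first substitutes for the variables below `n`, and the
    -- variable `n`, bound by then, is left to this redex.
    refine ⟨T.comp (.absApp n .hole (eraser k)), fun M => ?_⟩
    rw [TestCtx.plug_comp]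
    refine (hT _).trans ?_
    simp only [TestCtx.plug, abs, subst, subst_eraser]
    refine (steps_app_lam _ (isValue_eraser k)).trans ?_
    rw [inst_subst_liftSubst, subst_rename]
    refine Eq.subst (motive := Steps _) ?_ .refl
    refine subst_congr (fun i => ?_) M
    rcases lt_trichotomy i n with h | rfl | h
    · simp [scons, h, h.ne, Nat.lt_succ_of_lt h]
    · simp [scons]
    · have h₁ : ¬ i < n := by omega
      have h₂ : ¬ i < n + 1 := by omega
      simp [scons, h.ne', h₁, h₂]

-- From the Taylor normal form to meaningfulness

theorem meaningful_of_taylorNF_nonempty {M : VTerm} (h : M.taylorNF.Nonempty) :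
    Meaningful M := by
  obtain ⟨u, _, ⟨m, rfl, hm⟩, hu⟩ := h
  obtain ⟨Γ, A, hA⟩ := ResPre.hasTy_of_isNormalFormOf hm.isSort hu
  obtain ⟨n, k, hσ⟩ := exists_realizesCtx_eraser Γ
  obtain ⟨V, hV, -, hs⟩ := exists_steps_realizes hm hA hσ
  obtain ⟨T, hT⟩ := exists_testCtx_steps k n
  exact ⟨T, V, hV, (hT M).trans hs⟩

end VTerm

theorem mainTheorem9 (M : VTerm) : M.Meaningful ↔ M.taylorNF.Nonempty :=
  ⟨VTerm.Meaningful.taylorNF_nonempty, VTerm.meaningful_of_taylorNF_nonempty⟩
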